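/- Let $\mathbb{F}_q$ be a finite field with $q$ elements, $\mathcal{R}=\mathbb{F}_q[x]$, $\mathcal{R}_{\le N}=\{Q\in\mathcal{R}:\deg Q\le N\}$, and let $\mathcal{K}_\infty=\mathbb{F}_q((x^{-1}))$ with the absolute value normalized by $|x|=q$. Write $\mathcal{O}=\{f\in\mathcal{K}_\infty:|f|\le 1\}$, and for $f=\sum_n a_nx^{-n}\in\mathcal{K}_\infty$ let $\langle f\rangle=\sum_{n\ge 1}a_nx^{-n}$ be its fractional part. Let $d\ge 2$ and let $m$ be the Haar measure on $\mathcal{K}_\infty^d$ with $m(\mathcal{O}^d)=1$. A lattice is a set $\Lambda=g\mathcal{R}^d$ with $g\in\mathrm{GL}_d(\mathcal{K}_\infty)$, and $\det\Lambda=|\det g|$; a convex body is a set $\mathcal{C}=h\mathcal{O}^d$ with $h\in\mathrm{GL}_d(\mathcal{K}_\infty)$. It defines the norm $\|w\|_{\mathcal{C}}=\min\{q^n : n\in\mathbb{Z},\ w\in x^n\mathcal{C}\}$ for $w\neq 0$, $\|0\|_{\mathcal{C}}=0$. For $S\subseteq\mathcal{K}_\infty^d$ and $i=1,\dots,d$,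 the $i$-th successive minimum is $$\lambda_{i,\mathcal{C}}(S)=\min\{r>0:\dim_{\mathcal{K}_\infty}\operatorname{span}_{\mathcal{K}_\infty}\{w\in S:\|w\|_{\mathcal{C}}\le r\}\ge i\}.$$ Let $\Lambda\subseteq\mathcal{K}_\infty^d$ be a lattice, $\mathcal{C}$ a convex body and $N\ge 0$ an integer. Let $\mathbf{v}^{(1)},\dots,\mathbf{v}^{(d)}$ be a basis of successive minima of $\Lambda$ with respect to $\mathcal{C}$, that is, linearly independent vectors of $\Lambda$ with $\|\mathbf{v}^{(i)}\|_{\mathcal{C}}=\lambda_{i,\mathcal{C}}(\Lambda)$ (such vectors always form an $\mathcal{R}$-basis of $\Lambda$). Let $\alpha=\sum_{i=1}^d\alpha_i\mathbf{v}^{(i)}$ be a nonzero vector with $\alpha_i\in\mathcal{K}_\infty$ and $\mathcal{R}_{\le N}\alpha_i\cap\mathcal{R}=\{0\}$ for every $i$, and put $\Lambda(\alpha,q^N)=\bigcup_{Q\in\mathcal{R}_{\le N}}(Q\alpha+\Lambda)$. Then the minima in the definitions of $\lambda_{i,\mathcal{C}}(\Lambda(\alpha,q^N))$, $i=1,\dots,d$,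 and of $$d(\Lambda(\alpha,q^N))=\min\left\{\left|\det\left(\langle Q_i\alpha_{j_\ell}\rangle\right)_{1\le i,\ell\le k}\right|>0\ :\ 1\le k\le d,\ 1\le j_1<\dots<j_k\le d,\ Q_1,\dots,Q_k\in\mathcal{R}_{\le N}\right\}$$ exist, and $$d(\Lambda(\alpha,q^N))\,\frac{\det\Lambda}{m(\mathcal{C})}\ \le\ \prod_{i=1}^d\lambda_{i,\mathcal{C}}(\Lambda(\alpha,q^N))\ \le\ \frac{\det\Lambda}{q^{N+1}m(\mathcal{C})}.$$ As a consequence, there exist $1\le k\le d$, indices $1\le\ell_1<\dots<\ell_k\le d$ and polynomials $Q_1,\dots,Q_k\in\mathcal{R}_{\le N}$ such that $$0\neq\left|\det\left(\langle Q_i\alpha_{\ell_j}\rangle\right)_{1\le i,j\le k}\right|\le\frac{1}{q^{N+1}}.$$ -/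

import Mathlib

open scoped LaurentSeries Polynomial WithZero

noncomputable section

namespace PeriodicLattice

/-- `K∞ = 𝔽_q((x⁻¹))`, the field of Laurent series in the variable `x⁻¹` over the finite field `F`;
the series `∑ aₙ x⁻ⁿ` has `n`-th coefficient `aₙ`. -/
abbrev Kinf (F : Type*) [Field F] : Type _ := F⸨X⸩

/-- The element `x` of `K∞`, i.e. the inverse of the variable `x⁻¹`. -/
def xElt (F : Type*) [Field F] : Kinf F := HahnSeries.single (-1 : ℤ) (1 : F)

/-- The embedding of `R = 𝔽_q[x]` in `K∞`, sending the polynomial variable to `x`. -/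
def polyEmb (F : Type*) [Field F] : F[X] →ₐ[F] Kinf F := Polynomial.aeval (xElt F)

/-- The fractional part `⟨f⟩`: the part of `f = ∑ aₙ x⁻ⁿ` with exponents `n ≥ 1`. -/
def frac {F : Type*} [Field F] (f : Kinf F) : Kinf F := f - HahnSeries.truncLT (1 : ℤ) f

theorem coeff_frac {F : Type*} [Field F] (f : Kinf F) (n : ℤ) :
    (frac f).coeff n = if 1 ≤ n then f.coeff n else 0 := by
  by_cases h : 1 ≤ n
  · have h' : ¬ n < 1 := not_lt.mpr h
    simp [frac, HahnSeries.truncLT, h, h']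
  · have h' : n < 1 := not_le.mp h
    simp [frac, HahnSeries.truncLT, h, h']

open Classical in
/-- The absolute value on `K∞`: `|f| = q ^ (-n)` where `n` is the least index of a nonzero
coefficient of `f` (so that `|x| = q`), and `|0| = 0`. -/
def absv {F : Type*} [Field F] [Fintype F] (f : Kinf F) : ℝ :=
  if f = 0 then 0 else (Fintype.card F : ℝ) ^ (-HahnSeries.order f)

/-- The unit cube `𝒪^d`, where `𝒪 = {f ∈ K∞ : |f| ≤ 1}`. -/
def unitCube (F : Type*) [Field F] [Fintype F] (d : ℕ) : Set (Fin d → Kinf F) :=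
  {v | ∀ i, absv (v i) ≤ 1}

theorem absv_le_one_iff {F : Type*} [Field F] [Fintype F] (f : Kinf F) :
    absv f ≤ 1 ↔ Valued.v f ≤ (1 : ℤᵐ⁰) := by
  have key := LaurentSeries.valuation_le_iff_coeff_lt_eq_zero F (D := 0) (f := f)
  rw [neg_zero, WithZero.exp_zero] at key
  rw [key]
  by_cases hf : f = 0
  · subst hf; simp [absv]
  have hq : (1 : ℝ) < (Fintype.card F : ℝ) := by exact_mod_cast Fintype.one_lt_card
  rw [absv, if_neg hf, zpow_le_one_iff_right₀ hq]
  constructor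
  · intro h n hn
    exact HahnSeries.coeff_eq_zero_of_lt_order (by omega)
  · intro h
    by_contra hlt
    exact HahnSeries.coeff_order_eq_zero.not.mpr hf (h _ (by omega))

theorem unitCube_eq_pi (F : Type*) [Field F] [Fintype F] (d : ℕ) :
    unitCube F d = Set.univ.pi fun _ => {f : Kinf F | Valued.v f ≤ (1 : ℤᵐ⁰)} := by
  ext v
  simp [unitCube, absv_le_one_iff, Set.mem_pi]

theorem isCompact_integers (F : Type*) [Field F] [Fintype F] :
    IsCompact {f : Kinf F | Valued.v f ≤ (1 : ℤᵐ⁰)} := by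
  let _ : TopologicalSpace F := ⊥
  have : DiscreteTopology F := ⟨rfl⟩
  let φ : (ℕ → F) → Kinf F := fun c => HahnSeries.ofPowerSeries ℤ F (PowerSeries.mk c)
  have hφ : Continuous φ := by
    rw [continuous_iff_continuousAt]
    intro c s hs
    obtain ⟨γ, hγ⟩ := Valued.mem_nhds.mp hs
    have hγ0 : MonoidWithZeroHom.ValueGroup₀.embedding γ.1 ≠ (0 : ℤᵐ⁰) := by
      intro h0
      exact γ.ne_zero ((map_eq_zero _).mp h0)
    obtain ⟨n, hn⟩ : ∃ n : ℕ, WithZero.exp (-(n : ℤ)) <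
        MonoidWithZeroHom.ValueGroup₀.embedding γ.1 := by
      refine ⟨(1 - WithZero.log (MonoidWithZeroHom.ValueGroup₀.embedding γ.1)).toNat, ?_⟩
      rw [← WithZero.lt_log_iff_exp_lt hγ0]
      omega
    have hU : (⋂ i ∈ Finset.range n, (fun c' : ℕ → F => c' i) ⁻¹' {c i}) ∈ nhds c :=
      (Filter.biInter_finset_mem _).mpr fun i _ =>
        (continuous_apply i).continuousAt.preimage_mem_nhds (by simp)
    rw [Filter.mem_map]
    refine Filter.mem_of_superset hU fun c' hc' => hγ ?_
    rw [Set.mem_ofPred_eq, Valuation.restrict_lt_iff_lt_embedding]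
    refine lt_of_le_of_lt ?_ hn
    rw [LaurentSeries.valuation_le_iff_coeff_lt_eq_zero]
    intro m hm
    simp only [φ, ← map_sub]
    rcases lt_or_ge m 0 with hm0 | hm0
    · rw [PowerSeries.coeff_coe, if_pos hm0]
    · obtain ⟨k, rfl⟩ := Int.eq_ofNat_of_zero_le hm0
      have hk := Set.mem_iInter₂.mp hc' k (Finset.mem_range.mpr (by omega))
      rw [LaurentSeries.coeff_coe_powerSeries]
      simpa [sub_eq_zero] using hk
  have himg : {f : Kinf F | Valued.v f ≤ (1 : ℤᵐ⁰)} = Set.range φ := by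
    ext f
    rw [Set.mem_ofPred_eq, LaurentSeries.val_le_one_iff_eq_coe]
    constructor
    · rintro ⟨P, rfl⟩
      refine ⟨fun n => PowerSeries.coeff n P, ?_⟩
      simp only [φ]
      congr 1
      ext n
      simp
    · rintro ⟨c, rfl⟩
      exact ⟨_, rfl⟩
  rw [himg]
  exact isCompact_range hφ

/-- The unit cube as a compact set with nonempty interior, for the product of the topology of `K∞`
defined by its valuation. -/
def unitCubeCompacts (F : Type*) [Field F] [Fintype F] (d : ℕ) :
    TopologicalSpace.PositiveCompacts (Fin d → Kinf F) where
  carrier := unitCube F d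
  isCompact' := by
    rw [unitCube_eq_pi]
    exact isCompact_univ_pi fun _ => isCompact_integers F
  interior_nonempty' := by
    have hopen : IsOpen (unitCube F d) := by
      rw [unitCube_eq_pi]
      exact isOpen_set_pi Set.finite_univ fun _ _ => Valued.isOpen_integer (Kinf F)
    rw [hopen.interior_eq]
    exact ⟨0, fun i => by simp [absv]⟩

/-- The Haar measure `m` on the Borel sets of `K∞^d`, normalized by `m(𝒪^d) = 1`. -/
def haar (F : Type*) [Field F] [Fintype F] (d : ℕ) :
    @MeasureTheory.Measure (Fin d → Kinf F) (borel _) :=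
  letI : MeasurableSpace (Fin d → Kinf F) := borel _
  haveI : BorelSpace (Fin d → Kinf F) := ⟨rfl⟩
  MeasureTheory.Measure.addHaarMeasure (unitCubeCompacts F d)

theorem haar_unitCube (F : Type*) [Field F] [Fintype F] (d : ℕ) :
    haar F d (unitCube F d) = 1 := by
  let _ : MeasurableSpace (Fin d → Kinf F) := borel _
  have : BorelSpace (Fin d → Kinf F) := ⟨rfl⟩
  exact MeasureTheory.Measure.addHaarMeasure_self (K₀ := unitCubeCompacts F d)

/-- The volume `m(C)` as a real number. -/
def vol {F : Type*} [Field F] [Fintype F] {d : ℕ} (C : Set (Fin d → Kinf F)) : ℝ :=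
  (haar F d C).toReal

/-- The convex body `h 𝒪^d`, for `h ∈ GL_d(K∞)`. -/
def convexBody {F : Type*} [Field F] [Fintype F] {d : ℕ} (h : GL (Fin d) (Kinf F)) :
    Set (Fin d → Kinf F) :=
  (fun w => (h : Matrix (Fin d) (Fin d) (Kinf F)).mulVec w) '' unitCube F d

/-- The lattice `g R^d`, for `g ∈ GL_d(K∞)`. -/
def lattice {F : Type*} [Field F] {d : ℕ} (g : GL (Fin d) (Kinf F)) : Set (Fin d → Kinf F) :=
  Set.range fun P : Fin d → F[X] =>
    (g : Matrix (Fin d) (Fin d) (Kinf F)).mulVec fun i => polyEmb F (P i)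

/-- The determinant `|det g|` of the lattice `g R^d`. -/
def latticeDet {F : Type*} [Field F] [Fintype F] {d : ℕ} (g : GL (Fin d) (Kinf F)) : ℝ :=
  absv (g : Matrix (Fin d) (Fin d) (Kinf F)).det

/-- The periodic set `Λ(α, q^N) = ⋃_{deg Q ≤ N} (Q α + Λ)`. -/
def periodic {F : Type*} [Field F] {d : ℕ} (Λ : Set (Fin d → Kinf F)) (α : Fin d → Kinf F)
    (N : ℕ) : Set (Fin d → Kinf F) :=
  ⋃ Q ∈ {Q : F[X] | Q.degree ≤ N}, (fun w => polyEmb F Q • α + w) '' Λ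

/-- The norm `‖w‖_C = min {r ∈ q^ℤ : w ∈ x^(log_q r) C}` defined by a convex body `C`, with
`‖0‖_C = 0`. -/
def bodyNorm {F : Type*} [Field F] [Fintype F] {d : ℕ} (C : Set (Fin d → Kinf F))
    (w : Fin d → Kinf F) : ℝ :=
  sInf {r : ℝ | ∃ n : ℤ, r = (Fintype.card F : ℝ) ^ n ∧ w ∈ (fun u => xElt F ^ n • u) '' C}

/-- The radii `r > 0` such that the points of `S` of `C`-norm at most `r` span a `K∞`-subspace of
dimension at least `i`. -/
def minimaRadii {F : Type*} [Field F] [Fintype F] {d : ℕ} (C S : Set (Fin d → Kinf F)) (i : ℕ) :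
    Set ℝ :=
  {r : ℝ | 0 < r ∧
    i ≤ Module.finrank (Kinf F) (Submodule.span (Kinf F) (S ∩ {w | bodyNorm C w ≤ r}))}

/-- The `i`-th successive minimum of `S` with respect to `C`, for `i = 1, …, d`. -/
def succMin {F : Type*} [Field F] [Fintype F] {d : ℕ} (C S : Set (Fin d → Kinf F)) (i : ℕ) : ℝ :=
  sInf (minimaRadii C S i)

/-- `v` is a family of successive minima of `S` with respect to `C`: linearly independent vectors
of `S`, the `i`-th of which has norm equal to the `i`-th successive minimum. For a lattice, such a
family is automatically a basis over `𝔽_q[x]`. The index `i : Fin d` starts at `0`. -/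
def IsSuccMinFamily {F : Type*} [Field F] [Fintype F] {d : ℕ} (C S : Set (Fin d → Kinf F))
    (v : Fin d → Fin d → Kinf F) : Prop :=
  (∀ i, v i ∈ S) ∧ LinearIndependent (Kinf F) v ∧
    ∀ i : Fin d, bodyNorm C (v i) = succMin C S (i + 1)

/-- The `k × k` matrix `(⟨Q_i a_{j_l}⟩)_{i,l}` of fractional parts. -/
def fracMatrix {F : Type*} [Field F] {d k : ℕ} (a : Fin d → Kinf F) (j : Fin k → Fin d)
    (Q : Fin k → F[X]) : Matrix (Fin k) (Fin k) (Kinf F) :=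
  Matrix.of fun i l => frac (polyEmb F (Q i) * a (j l))

/-- The nonzero absolute values of the determinants of the matrices of fractional parts
`(⟨Q_i a_{j_l}⟩)` of sizes `k = 1, …, d`, with `j_1 < ⋯ < j_k` and `deg Q_i ≤ N`. -/
def fracMinors {F : Type*} [Field F] [Fintype F] {d : ℕ} (a : Fin d → Kinf F) (N : ℕ) : Set ℝ :=
  {t : ℝ | ∃ k : ℕ, 1 ≤ k ∧ k ≤ d ∧ ∃ (j : Fin k ↪o Fin d) (Q : Fin k → F[X]),
    (∀ i, (Q i).degree ≤ N) ∧ t = absv (fracMatrix a j Q).det ∧ 0 < t}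

/-- The quantity `d(Λ(α, q^N))`, the least element of `fracMinors`; here `a` is the family of
coordinates of `α` in the chosen basis of `Λ`. -/
def minFracMinor {F : Type*} [Field F] [Fintype F] {d : ℕ} (a : Fin d → Kinf F) (N : ℕ) : ℝ :=
  sInf (fracMinors a N)

end PeriodicLattice

end

noncomputable section

namespace PeriodicLattice

/-! Write C = h𝒪^d and Λ = gR^d. Applying h⁻¹ turns the C-norm into the maximum norm and Λ into A
R^d with A = h⁻¹g, and det Λ / m(C) = |det A| because m(h𝒪^d) = |det h|. Since R_{≤N} is closed
under addition, L = Λ(α, q^N) is a group; since α ≠ 0, the condition on the α_i makes the q^(N+1)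
vectors Qα distinct modulo Λ, so Λ has index q^(N+1) in L.

The upper bound is Minkowski's second theorem for L (`card_mul_prod_zpow_le`). The flag spanned by
vectors realizing the minima q^(l_i) of L has an adapted basis u_i of norm at most 1 and determinant
of absolute value 1. The body {∑ c_i u_i : |c_i| ≤ q^(l_i - 1)}, of volume q^(-d) ∏ q^(l_i), meets L
only in 0. Its translates by representatives of L/Λ are therefore disjoint modulo Λ, and their total
volume is at most that of a fundamental domain, q^(-d) |det A|.

For the lower bound, Minkowski's theorem for Λ itself and Hadamard's inequality give ∏ ‖v_i‖ = |det
A|, so the basis v is orthogonal in the ultrametric sense: |c_j| ‖v_j‖ ≤ ‖∑ c_i v_i‖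
(`absv_mul_supNorm_le_of_det_eq`). Splitting the coordinates of a point of L into polynomial and
fractional parts thus never needs longer vectors, and d independent vectors within the minima can be
chosen among the ∑ ⟨Q α_j⟩ v_j and the v_j (`IsReduced.mem_span_reducedVectors`). By Hadamard ∏ λ_i
≥ |det C| |det A|, where C is their coordinate matrix; expansion along the unit rows leaves a minor
of fractional parts.

Comparing the two bounds shows that the least minor is at most q^(-(N+1)). -/

theorem xElt_ne_zero {F : Type*} [Field F] : xElt F ≠ 0 := HahnSeries.single_ne_zero one_ne_zero

/-! ### The ultrametric absolute value on `K∞`. -/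

section AbsoluteValue

variable {F : Type*} [Field F] [Fintype F]

theorem one_lt_card_real (F : Type*) [Field F] [Fintype F] : (1 : ℝ) < (Fintype.card F : ℝ) := by
  exact_mod_cast Fintype.one_lt_card

theorem card_zpow_pos (F : Type*) [Field F] [Fintype F] (n : ℤ) :
    (0 : ℝ) < (Fintype.card F : ℝ) ^ n :=
  zpow_pos (zero_lt_one.trans (one_lt_card_real F)) n

@[simp] theorem absv_zero : absv (0 : Kinf F) = 0 := by simp [absv]

theorem absv_of_ne_zero {f : Kinf F} (hf : f ≠ 0) :
    absv f = (Fintype.card F : ℝ) ^ (-HahnSeries.order f) := by simp [absv, hf]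

theorem absv_pos {f : Kinf F} (hf : f ≠ 0) : 0 < absv f := by
  rw [absv_of_ne_zero hf]; exact card_zpow_pos F _

theorem absv_nonneg (f : Kinf F) : 0 ≤ absv f := by
  by_cases hf : f = 0
  · simp [hf]
  · exact (absv_pos hf).le

theorem absv_eq_zero {f : Kinf F} : absv f = 0 ↔ f = 0 :=
  ⟨fun h => by_contra fun hf => (absv_pos hf).ne' h, fun h => by simp [h]⟩

theorem absv_le_zpow_iff {f : Kinf F} {n : ℤ} :
    absv f ≤ (Fintype.card F : ℝ) ^ n ↔ ∀ m < -n, f.coeff m = 0 := by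
  by_cases hf : f = 0
  · simp [hf, (card_zpow_pos F n).le]
  · rw [absv_of_ne_zero hf, zpow_le_zpow_iff_right₀ (one_lt_card_real F), ← neg_le_neg_iff,
      neg_neg, HahnSeries.le_order_iff_forall hf]

theorem absv_mul (f g : Kinf F) : absv (f * g) = absv f * absv g := by
  by_cases hf : f = 0
  · simp [hf]
  by_cases hg : g = 0
  · simp [hg]
  rw [absv_of_ne_zero hf, absv_of_ne_zero hg, absv_of_ne_zero (mul_ne_zero hf hg),
    HahnSeries.order_mul hf hg, neg_add, zpow_add₀ (by positivity)]

theorem absv_add_le_max (f g : Kinf F) : absv (f + g) ≤ max (absv f) (absv g) := by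
  by_cases hf : f = 0
  · simp [hf]
  by_cases hg : g = 0
  · simp [hg]
  by_cases hfg : f + g = 0
  · rw [hfg, absv_zero]; exact le_max_of_le_left (absv_nonneg f)
  have := HahnSeries.min_order_le_order_add hfg
  rw [absv_of_ne_zero hf, absv_of_ne_zero hg, absv_of_ne_zero hfg, le_max_iff]
  simp only [zpow_le_zpow_iff_right₀ (one_lt_card_real F), neg_le_neg_iff]
  exact min_le_iff.mp this

/-- The absolute value of `K∞` as a bundled absolute value. -/
def absvHom (F : Type*) [Field F] [Fintype F] : AbsoluteValue (Kinf F) ℝ where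
  toFun := absv
  map_mul' := absv_mul
  nonneg' := absv_nonneg
  eq_zero' _ := absv_eq_zero
  add_le' f g := (absv_add_le_max f g).trans
    (max_le_add_of_nonneg (absv_nonneg f) (absv_nonneg g))

theorem absvHom_apply (f : Kinf F) : absvHom F f = absv f := rfl

@[simp] theorem absv_one : absv (1 : Kinf F) = 1 := map_one (absvHom F)

@[simp] theorem absv_neg (f : Kinf F) : absv (-f) = absv f := (absvHom F).map_neg f

theorem absv_sub_le_max (f g : Kinf F) : absv (f - g) ≤ max (absv f) (absv g) := by
  simpa [sub_eq_add_neg] using absv_add_le_max f (-g)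

theorem absv_inv (f : Kinf F) : absv f⁻¹ = (absv f)⁻¹ := map_inv₀ (absvHom F) f

theorem absv_prod {ι : Type*} (s : Finset ι) (f : ι → Kinf F) :
    absv (∏ i ∈ s, f i) = ∏ i ∈ s, absv (f i) := map_prod (absvHom F) f s

theorem absv_sum_le {ι : Type*} (s : Finset ι) (f : ι → Kinf F) {r : ℝ} (hr : 0 ≤ r)
    (h : ∀ i ∈ s, absv (f i) ≤ r) : absv (∑ i ∈ s, f i) ≤ r := by
  classical
  induction s using Finset.induction_on with
  | empty => simpa using hr
  | insert a s ha ih =>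
    rw [Finset.sum_insert ha]
    exact (absv_add_le_max _ _).trans (max_le (h a (by simp))
      (ih fun i hi => h i (Finset.mem_insert_of_mem hi)))

theorem absv_xElt : absv (xElt F) = Fintype.card F := by
  rw [absv_of_ne_zero xElt_ne_zero, xElt, HahnSeries.order_single one_ne_zero]; simp

theorem absv_xElt_zpow (n : ℤ) : absv (xElt F ^ n) = (Fintype.card F : ℝ) ^ n := by
  rw [← absv_xElt]; exact map_zpow₀ (absvHom F) _ n

theorem exists_absv_eq_zpow {f : Kinf F} (hf : f ≠ 0) :
    ∃ n : ℤ, absv f = (Fintype.card F : ℝ) ^ n := ⟨_, absv_of_ne_zero hf⟩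

/-- The nonzero values are powers of q, so a strict inequality gains a full factor q. This is the
source of the exponents lowered by 1 below. -/
theorem absv_lt_zpow_iff {f : Kinf F} {n : ℤ} :
    absv f < (Fintype.card F : ℝ) ^ n ↔ absv f ≤ (Fintype.card F : ℝ) ^ (n - 1) := by
  by_cases hf : f = 0
  · simp [hf, card_zpow_pos F, (card_zpow_pos F _).le]
  · rw [absv_of_ne_zero hf, zpow_le_zpow_iff_right₀ (one_lt_card_real F),
      zpow_lt_zpow_iff_right₀ (one_lt_card_real F)]
    omega

end AbsoluteValue

/-! ### Polynomial and fractional parts. -/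

section FractionalPart

variable {F : Type*} [Field F]

theorem xElt_pow (n : ℕ) : xElt F ^ n = HahnSeries.single (-(n : ℤ)) (1 : F) := by
  rw [xElt, HahnSeries.single_pow]; simp

theorem coeff_polyEmb (P : F[X]) (m : ℤ) :
    (polyEmb F P).coeff m = if m ≤ 0 then P.coeff (-m).toNat else 0 := by
  have key : ∀ n : ℕ, ((Polynomial.C (P.coeff n) * Polynomial.X ^ n).aeval (xElt F)).coeff m =
      if m = -(n : ℤ) then P.coeff n else 0 := by
    intro n
    rw [map_mul, map_pow, Polynomial.aeval_C, Polynomial.aeval_X, LaurentSeries.algebraMap_apply, xElt_pow,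
      HahnSeries.C_mul_eq_smul, HahnSeries.coeff_smul, HahnSeries.coeff_single]
    split_ifs <;> simp
  conv_lhs => rw [P.as_sum_range_C_mul_X_pow, polyEmb, map_sum, HahnSeries.coeff_sum]
  rw [Finset.sum_congr rfl fun n _ => key n]
  split_ifs with hm
  · rw [Finset.sum_eq_single (-m).toNat]
    · rw [if_pos (by omega)]
    · intro b _ hb
      rw [if_neg (by omega)]
    · intro h
      rw [if_pos (by omega)]
      exact Polynomial.coeff_eq_zero_of_natDegree_lt (by simpa using h)
  · exact Finset.sum_eq_zero fun n _ => if_neg (by omega)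

theorem polyEmb_injective : Function.Injective (polyEmb F) := by
  intro P Q h
  ext n
  have := congrArg (fun f : Kinf F => f.coeff (-(n : ℤ))) h
  simpa [coeff_polyEmb] using this

theorem exists_polyEmb_eq {f : Kinf F} (hf : ∀ m, 1 ≤ m → f.coeff m = 0) :
    ∃ P, polyEmb F P = f := by
  refine ⟨∑ n ∈ Finset.range ((-f.order).toNat + 1), Polynomial.monomial n (f.coeff (-(n : ℤ))), ?_⟩
  ext m
  rw [coeff_polyEmb]
  split_ifs with hm
  · simp only [Polynomial.finsetSum_coeff, Polynomial.coeff_monomial, Finset.sum_ite_eq',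
      Finset.mem_range]
    split_ifs with h
    · congr 1; omega
    · symm; apply HahnSeries.coeff_eq_zero_of_lt_order; omega
  · exact (hf m (by omega)).symm

theorem exists_polyEmb_eq_sub_frac (f : Kinf F) : ∃ P, polyEmb F P = f - frac f :=
  exists_polyEmb_eq fun m hm => by simp [coeff_frac, hm]

theorem frac_polyEmb (P : F[X]) : frac (polyEmb F P) = 0 := by
  ext m
  rw [coeff_frac, coeff_polyEmb]
  split_ifs <;> first | rfl | omega

theorem frac_eq_zero_iff {f : Kinf F} : frac f = 0 ↔ f ∈ Set.range (polyEmb F) := by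
  constructor
  · intro h
    obtain ⟨P, hP⟩ := exists_polyEmb_eq_sub_frac f
    exact ⟨P, by rw [hP, h, sub_zero]⟩
  · rintro ⟨P, rfl⟩
    exact frac_polyEmb P

variable [Fintype F]

theorem absv_frac_le (f : Kinf F) : absv (frac f) ≤ absv f := by
  by_cases hf : f = 0
  · have : frac f = 0 := by ext m; simp [coeff_frac, hf]
    rw [this, absv_zero]; exact absv_nonneg f
  · obtain ⟨n, hn⟩ := exists_absv_eq_zpow hf
    have h := hn.le
    rw [hn]
    rw [absv_le_zpow_iff] at h ⊢
    intro m hm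
    simp [coeff_frac, h m hm]

theorem absv_sub_frac_le (f : Kinf F) : absv (f - frac f) ≤ absv f :=
  (absv_sub_le_max _ _).trans (max_le le_rfl (absv_frac_le f))

theorem absv_frac_lt_one (f : Kinf F) : absv (frac f) < 1 := by
  have := (absv_lt_zpow_iff (f := frac f) (n := 0)).mpr
    (absv_le_zpow_iff.mpr fun m hm => by simp [coeff_frac, show ¬ 1 ≤ m by omega])
  simpa using this

/-- Discreteness of R in `K∞`: an element of absolute value below 1 has coefficients only at indices
n ≥ 1, where a polynomial has none. -/
theorem one_le_absv_polyEmb {P : F[X]} (hP : P ≠ 0) : 1 ≤ absv (polyEmb F P) := by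
  by_contra! h
  have h' := (absv_lt_zpow_iff (f := polyEmb F P) (n := 0)).mp (by simpa using h)
  rw [absv_le_zpow_iff] at h'
  refine hP (polyEmb_injective ?_)
  rw [map_zero]
  ext m
  by_cases hm : m < 1
  · simpa using h' m (by omega)
  · simp [coeff_polyEmb, show ¬ m ≤ 0 by omega]

end FractionalPart

/-! ### The maximum norm and norms of convex bodies. -/

section SupNorm

variable {F : Type*} [Field F] [Fintype F] {d : ℕ}

/-- The maximum norm on `K∞^d`. -/
def supNorm (w : Fin d → Kinf F) : ℝ := ⨆ i, absv (w i)

theorem absv_le_supNorm (w : Fin d → Kinf F) (i : Fin d) : absv (w i) ≤ supNorm w :=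
  le_ciSup (f := fun i => absv (w i)) (Set.finite_range _).bddAbove i

theorem supNorm_nonneg (w : Fin d → Kinf F) : 0 ≤ supNorm w :=
  Real.iSup_nonneg fun i => absv_nonneg (w i)

theorem supNorm_le_iff {w : Fin d → Kinf F} {r : ℝ} (hr : 0 ≤ r) :
    supNorm w ≤ r ↔ ∀ i, absv (w i) ≤ r :=
  ⟨fun h i => (absv_le_supNorm w i).trans h, fun h => Real.iSup_le h hr⟩

theorem exists_supNorm_eq {w : Fin d → Kinf F} (hw : w ≠ 0) :
    ∃ i, w i ≠ 0 ∧ supNorm w = absv (w i) := by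
  obtain ⟨i₀, hi₀⟩ := Function.ne_iff.mp hw
  have : Nonempty (Fin d) := ⟨i₀⟩
  obtain ⟨i, hi⟩ := exists_eq_ciSup_of_finite (f := fun i => absv (w i))
  refine ⟨i, fun h => ?_, hi.symm⟩
  have := (absv_pos hi₀).trans_le (absv_le_supNorm w i₀)
  rw [supNorm, ← hi, h, absv_zero] at this
  exact lt_irrefl _ this

theorem exists_supNorm_eq_zpow {w : Fin d → Kinf F} (hw : w ≠ 0) :
    ∃ n : ℤ, supNorm w = (Fintype.card F : ℝ) ^ n := by
  obtain ⟨i, hi, h⟩ := exists_supNorm_eq hw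
  rw [h]; exact exists_absv_eq_zpow hi

@[simp] theorem supNorm_zero : supNorm (0 : Fin d → Kinf F) = 0 := by
  simp [supNorm]

theorem supNorm_pos {w : Fin d → Kinf F} (hw : w ≠ 0) : 0 < supNorm w := by
  obtain ⟨n, hn⟩ := exists_supNorm_eq_zpow hw
  rw [hn]; exact card_zpow_pos F n

theorem supNorm_add_le (v w : Fin d → Kinf F) : supNorm (v + w) ≤ max (supNorm v) (supNorm w) :=
  (supNorm_le_iff (le_max_of_le_left (supNorm_nonneg v))).mpr fun i =>
    (absv_add_le_max _ _).trans (max_le_max (absv_le_supNorm v i) (absv_le_supNorm w i))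

theorem supNorm_smul (c : Kinf F) (w : Fin d → Kinf F) : supNorm (c • w) = absv c * supNorm w := by
  simp only [supNorm, Pi.smul_apply, smul_eq_mul, absv_mul]
  exact (Real.mul_iSup_of_nonneg (absv_nonneg c) _).symm

@[simp] theorem supNorm_neg (w : Fin d → Kinf F) : supNorm (-w) = supNorm w := by
  simp [supNorm]

theorem supNorm_sub_le (v w : Fin d → Kinf F) : supNorm (v - w) ≤ max (supNorm v) (supNorm w) := by
  simpa [sub_eq_add_neg] using supNorm_add_le v (-w)

theorem supNorm_sum_le {ι : Type*} (s : Finset ι) (f : ι → Fin d → Kinf F) {r : ℝ} (hr : 0 ≤ r)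
    (h : ∀ i ∈ s, supNorm (f i) ≤ r) : supNorm (∑ i ∈ s, f i) ≤ r :=
  (supNorm_le_iff hr).mpr fun i => by
    rw [Finset.sum_apply]
    exact absv_sum_le s _ hr fun k hk => (absv_le_supNorm _ i).trans (h k hk)

theorem mem_unitCube_iff {w : Fin d → Kinf F} : w ∈ unitCube F d ↔ supNorm w ≤ 1 :=
  (supNorm_le_iff zero_le_one).symm

theorem mem_convexBody_iff {h : GL (Fin d) (Kinf F)} {w : Fin d → Kinf F} :
    w ∈ convexBody h ↔ supNorm ((h⁻¹ : GL _ _).1.mulVec w) ≤ 1 := by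
  rw [← mem_unitCube_iff]
  constructor
  · rintro ⟨u, hu, rfl⟩
    simpa [Matrix.mulVec_mulVec, ← Units.val_mul] using hu
  · intro hw
    exact ⟨_, hw, by simp [Matrix.mulVec_mulVec]⟩

theorem bodyNorm_convexBody (h : GL (Fin d) (Kinf F)) (w : Fin d → Kinf F) :
    bodyNorm (convexBody h) w = supNorm ((h⁻¹ : GL _ _).1.mulVec w) := by
  set w' := (h⁻¹ : GL _ _).1.mulVec w with hw'
  have hset : {r : ℝ | ∃ n : ℤ, r = (Fintype.card F : ℝ) ^ n ∧
      w ∈ (fun u => xElt F ^ n • u) '' convexBody h} =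
      {r : ℝ | ∃ n : ℤ, r = (Fintype.card F : ℝ) ^ n ∧ supNorm w' ≤ r} := by
    ext r
    refine exists_congr fun n => and_congr_right fun hr => ?_
    have hx : xElt F ^ n ≠ 0 := zpow_ne_zero _ xElt_ne_zero
    have : w ∈ (fun u => xElt F ^ n • u) '' convexBody h ↔
        (xElt F ^ n)⁻¹ • w ∈ convexBody h := by
      constructor
      · rintro ⟨u, hu, rfl⟩
        simpa [smul_smul, hx] using hu
      · intro hu
        exact ⟨_, hu, by simp [smul_smul, hx]⟩
    rw [this, mem_convexBody_iff, Matrix.mulVec_smul, supNorm_smul, absv_inv, absv_xElt_zpow, ← hw',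
      hr, inv_mul_le_one₀ (card_zpow_pos F n)]
  rw [bodyNorm, hset]
  -- For the zero vector every power of q is admissible; the infimum 0 is not attained but agrees
  -- with the convention ‖0‖ = 0.
  by_cases h0 : w' = 0
  · rw [h0, supNorm_zero]
    refine le_antisymm (le_of_forall_pos_lt_add fun ε hε => ?_)
      (Real.sInf_nonneg fun r hr => hr.choose_spec.2)
    obtain ⟨n, hn⟩ := exists_pow_lt_of_lt_one hε (inv_lt_one_of_one_lt₀ (one_lt_card_real F))
    rw [zero_add]
    refine lt_of_le_of_lt (csInf_le ⟨0, fun r hr => hr.choose_spec.2⟩ ⟨-n, rfl, ?_⟩)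
      (by simpa using hn)
    exact (card_zpow_pos F _).le
  · obtain ⟨n, hn⟩ := exists_supNorm_eq_zpow h0
    exact IsLeast.csInf_eq ⟨⟨n, hn, le_rfl⟩, fun r hr => hr.choose_spec.2⟩

end SupNorm

/-! ### Hadamard's inequality and its equality case. -/

section Determinant

variable {F : Type*} [Field F] [Fintype F] {d : ℕ}

/-- Hadamard's inequality for the maximum norm. -/
theorem absv_det_le (W : Matrix (Fin d) (Fin d) (Kinf F)) :
    absv W.det ≤ ∏ i, supNorm (W i) := by
  rw [← Matrix.det_transpose, Matrix.det_apply]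
  refine absv_sum_le _ _ (Finset.prod_nonneg fun i _ => supNorm_nonneg _) fun σ _ => ?_
  have : absv (∏ i, W.transpose (σ i) i) ≤ ∏ i, supNorm (W i) := by
    rw [absv_prod]
    exact Finset.prod_le_prod (fun i _ => absv_nonneg _) fun i _ => absv_le_supNorm (W i) (σ i)
  rcases Int.units_eq_one_or (Equiv.Perm.sign σ) with h | h <;> simpa [h] using this

/-- Vectors for which equality holds in Hadamard's inequality are orthogonal. -/
theorem absv_mul_supNorm_le_of_det_eq (W : Matrix (Fin d) (Fin d) (Kinf F)) (hW : W.det ≠ 0)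
    (h : absv W.det = ∏ i, supNorm (W i)) (c : Fin d → Kinf F) (j : Fin d) :
    absv (c j) * supNorm (W j) ≤ supNorm (∑ i, c i • W i) := by
  -- Replacing row j by ∑ c_i W_i multiplies the determinant by c_j; Hadamard's inequality for the
  -- new matrix gives the claim once the norms of the other rows are cancelled.
  have h1 := absv_det_le (W.updateRow j (∑ i, c i • W i))
  rw [Matrix.det_updateRow_sum, smul_eq_mul, absv_mul, h,
    ← Finset.mul_prod_erase _ _ (Finset.mem_univ j), ← Finset.mul_prod_erase _ _ (Finset.mem_univ j),
    Matrix.updateRow_self] at h1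
  have h2 : ∏ i ∈ Finset.univ.erase j, supNorm (W.updateRow j (∑ i, c i • W i) i) =
      ∏ i ∈ Finset.univ.erase j, supNorm (W i) :=
    Finset.prod_congr rfl fun i hi => by rw [Matrix.updateRow_ne (Finset.ne_of_mem_erase hi)]
  have h3 : 0 < ∏ i, supNorm (W i) := h ▸ absv_pos hW
  rw [← Finset.mul_prod_erase _ _ (Finset.mem_univ j)] at h3
  have h4 : 0 < ∏ i ∈ Finset.univ.erase j, supNorm (W i) :=
    pos_of_mul_pos_right h3 (supNorm_nonneg _)
  rw [h2, ← mul_assoc] at h1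
  exact le_of_mul_le_mul_right h1 h4

end Determinant

/-! ### Norm-preserving Gaussian elimination along a flag. -/

section Echelon

variable {F : Type*} [Field F] [Fintype F] {d : ℕ}

/-- The conditions on the `i`-th vector of an echelon family adapted to the flag spanned by `w`,
with pivot columns `p`. -/
structure IsEchelonAt (w u : Fin d → Fin d → Kinf F) (p : Fin d → Fin d) (i : Fin d) : Prop where
  mem : u i ∈ Submodule.span (Kinf F) (w '' Set.Iic i)
  notMem : u i ∉ Submodule.span (Kinf F) (w '' Set.Iio i)
  norm_le : supNorm (u i) ≤ 1
  pivot : u i (p i) = 1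
  zero : ∀ j < i, u i (p j) = 0

/-- The pivot columns are cleared in increasing order. Subtracting a multiple of `u k` does not
disturb earlier ones, where `u k` vanishes. -/
theorem exists_sub_mem_span_apply_eq_zero {w u : Fin d → Fin d → Kinf F} {p : Fin d → Fin d}
    (n : Fin d) (hu : ∀ i < n, IsEchelonAt w u p i) (y : Fin d → Kinf F) (m : ℕ) (hm : m ≤ n) :
    ∃ z, y - z ∈ Submodule.span (Kinf F) (w '' Set.Iio n) ∧
      ∀ j : Fin d, (j : ℕ) < m → z (p j) = 0 := by
  induction m with
  | zero => exact ⟨y, by simp, fun j hj => absurd hj (by simp)⟩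
  | succ m ih =>
    obtain ⟨z, hz, hz0⟩ := ih (by omega)
    let k : Fin d := ⟨m, by omega⟩
    have hk : k < n := Fin.lt_def.mpr (show m < n by omega)
    have huk := hu k hk
    refine ⟨z - z (p k) • u k, ?_, fun j hj => ?_⟩
    · rw [show y - (z - z (p k) • u k) = (y - z) + z (p k) • u k by abel]
      refine add_mem hz (Submodule.smul_mem _ _ (Submodule.span_mono (Set.image_mono ?_) huk.mem))
      exact fun i (hi : i ≤ k) => lt_of_le_of_lt hi hk
    · rcases Nat.lt_succ_iff_lt_or_eq.mp hj with h | h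
      · simp [hz0 j h, huk.zero j (Fin.lt_def.mpr h)]
      · obtain rfl : j = k := Fin.ext h
        simp [huk.pivot]

/-- After the earlier pivots are cleared from `w k`, the remainder is nonzero by independence.
Dividing by its entry of largest absolute value makes that entry the pivot 1 and brings the norm
down to 1. -/
theorem exists_isEchelonAt {w : Fin d → Fin d → Kinf F} (hw : LinearIndependent (Kinf F) w) :
    ∃ u p, ∀ i, IsEchelonAt w u p i := by
  suffices h : ∀ n : ℕ, n ≤ d → ∃ u p, ∀ i : Fin d, (i : ℕ) < n → IsEchelonAt w u p i by
    obtain ⟨u, p, h⟩ := h d le_rfl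
    exact ⟨u, p, fun i => h i i.2⟩
  intro n
  induction n with
  | zero => exact fun _ => ⟨0, id, fun i hi => absurd hi (by simp)⟩
  | succ n ih =>
    intro hn
    obtain ⟨u, p, h⟩ := ih (by omega)
    let k : Fin d := ⟨n, hn⟩
    obtain ⟨z, hz, hz0⟩ := exists_sub_mem_span_apply_eq_zero (w := w) k
      (fun i hi => h i (Fin.lt_def.mp hi)) (w k) n le_rfl
    have hwk : w k ∉ Submodule.span (Kinf F) (w '' Set.Iio k) :=
      hw.notMem_span_image (by simp)
    have hzn : z ∉ Submodule.span (Kinf F) (w '' Set.Iio k) := fun h =>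
      hwk (by simpa using add_mem hz h)
    have hzm : z ∈ Submodule.span (Kinf F) (w '' Set.Iic k) := by
      have h1 : w k ∈ Submodule.span (Kinf F) (w '' Set.Iic k) :=
        Submodule.subset_span ⟨k, by simp, rfl⟩
      have h2 := Submodule.span_mono (Set.image_mono (f := w) Set.Iio_subset_Iic_self) hz
      simpa using sub_mem h1 h2
    obtain ⟨q, hq, hqn⟩ := exists_supNorm_eq (w := z) (fun h => hzn (h ▸ zero_mem _))
    refine ⟨Function.update u k ((z q)⁻¹ • z), Function.update p k q, fun i hi => ?_⟩
    have hlt : ∀ j < k, Function.update p k q j = p j := fun j hj =>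
      Function.update_of_ne hj.ne _ _
    rcases Nat.lt_succ_iff_lt_or_eq.mp hi with hi | hi
    · have hik : i < k := Fin.lt_def.mpr hi
      obtain ⟨h1, h2, h3, h4, h5⟩ := h i hi
      refine ⟨?_, ?_, ?_, ?_, fun j hj => ?_⟩
      all_goals rw [Function.update_of_ne hik.ne]
      · exact h1
      · exact h2
      · exact h3
      · rwa [hlt i hik]
      · rw [hlt j (hj.trans hik)]
        exact h5 j hj
    · obtain rfl : i = k := Fin.ext hi
      refine ⟨?_, ?_, ?_, ?_, fun j hj => ?_⟩
      all_goals rw [Function.update_self]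
      · exact Submodule.smul_mem _ _ hzm
      · rwa [Submodule.smul_mem_iff _ (inv_ne_zero hq)]
      · rw [supNorm_smul, hqn, absv_inv, inv_mul_cancel₀ (absv_pos hq).ne']
      · simp [hq]
      · rw [hlt j hj]
        simp [hz0 j (Fin.lt_def.mp hj)]

/-- The pivot columns are distinct, and permuting the columns by `p` makes the matrix upper
triangular with unit diagonal. -/
theorem absv_det_of_isEchelonAt {w u : Fin d → Fin d → Kinf F} {p : Fin d → Fin d}
    (hu : ∀ i, IsEchelonAt w u p i) : absv (Matrix.of u).det = 1 := by
  have hp : Function.Injective p := by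
    intro i j hij
    rcases lt_trichotomy i j with h | h | h
    · have := (hu j).zero i h
      rw [hij, (hu j).pivot] at this
      exact absurd this one_ne_zero
    · exact h
    · have := (hu i).zero j h
      rw [← hij, (hu i).pivot] at this
      exact absurd this one_ne_zero
  let e : Equiv.Perm (Fin d) := Equiv.ofBijective p (Finite.injective_iff_bijective.mp hp)
  have h1 := Matrix.det_permute' e (Matrix.of u)
  have h2 : ((Matrix.of u).submatrix id e).det = 1 := by
    rw [Matrix.det_of_isUpperTriangular]
    · exact Finset.prod_eq_one fun i _ => (hu i).pivot
    · exact fun i j hij => (hu i).zero j hij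
  rw [h2] at h1
  have h3 := congrArg absv h1
  rw [absv_one, absv_mul] at h3
  rcases Int.units_eq_one_or (Equiv.Perm.sign e) with h | h <;> simpa [h] using h3.symm

end Echelon

/-! ### Haar measure under linear maps. -/

section Volume

variable {F : Type*} [Field F] {d : ℕ}

/-- The Borel sets of `K∞^d`. -/
@[reducible] def borelSpaceKinf (F : Type*) [Field F] (d : ℕ) :
    MeasurableSpace (Fin d → Kinf F) := borel _

attribute [local instance] borelSpaceKinf

theorem borelSpace_kinf (F : Type*) [Field F] (d : ℕ) : BorelSpace (Fin d → Kinf F) := ⟨rfl⟩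

attribute [local instance] borelSpace_kinf

/-- An invertible matrix as a topological automorphism of `K∞^d`. -/
def mulVecEquiv (A : GL (Fin d) (Kinf F)) : (Fin d → Kinf F) ≃ₜ+ (Fin d → Kinf F) where
  toFun := A.1.mulVec
  invFun := (A⁻¹ : GL _ _).1.mulVec
  left_inv w := by simp [Matrix.mulVec_mulVec]
  right_inv w := by simp [Matrix.mulVec_mulVec]
  map_add' := Matrix.mulVec_add A.1
  continuous_toFun := Continuous.matrix_mulVec continuous_const continuous_id
  continuous_invFun := Continuous.matrix_mulVec continuous_const continuous_id

theorem mulVecEquiv_apply (A : GL (Fin d) (Kinf F)) (w : Fin d → Kinf F) :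
    mulVecEquiv A w = A.1.mulVec w := rfl

/-- The diagonal matrix with given invertible entries. -/
def diagGL : (Fin d → (Kinf F)ˣ) →* GL (Fin d) (Kinf F) where
  toFun a := ⟨Matrix.diagonal fun i => (a i : Kinf F), Matrix.diagonal fun i => ((a i)⁻¹ : (Kinf F)ˣ),
    by simp [Matrix.diagonal_mul_diagonal], by simp [Matrix.diagonal_mul_diagonal]⟩
  map_one' := Units.ext (by simp)
  map_mul' a b := Units.ext (by simp [Matrix.diagonal_mul_diagonal])

theorem coe_diagGL (a : Fin d → (Kinf F)ˣ) :
    (diagGL a).1 = Matrix.diagonal fun i => (a i : Kinf F) := rfl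

variable [Fintype F]

theorem isOpen_unitCube : IsOpen (unitCube F d) := by
  rw [unitCube_eq_pi]
  exact isOpen_set_pi Set.finite_univ fun _ _ => Valued.isOpen_integer (Kinf F)

theorem isOpen_convexBody (A : GL (Fin d) (Kinf F)) : IsOpen (convexBody A) :=
  (mulVecEquiv A).toHomeomorph.isOpenMap _ isOpen_unitCube

theorem locallyCompactSpace_kinf (F : Type*) [Field F] [Fintype F] (d : ℕ) :
    LocallyCompactSpace (Fin d → Kinf F) :=
  (unitCubeCompacts F d).locallyCompactSpace_of_addGroup

attribute [local instance] locallyCompactSpace_kinf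

instance isAddHaarMeasure_haar : (haar F d).IsAddHaarMeasure :=
  MeasureTheory.Measure.isAddHaarMeasure_addHaarMeasure _

instance regular_haar : (haar F d).Regular :=
  MeasureTheory.Measure.regular_addHaarMeasure

/-- The factor by which an invertible matrix scales the Haar measure. -/
def scaleHom (F : Type*) [Field F] [Fintype F] (d : ℕ) : GL (Fin d) (Kinf F) →* NNReal where
  toFun A := MeasureTheory.addEquivAddHaarChar (mulVecEquiv A)
  map_one' := by
    rw [← MeasureTheory.addEquivAddHaarChar_refl (G := Fin d → Kinf F)]
    congr 1
    ext w : 1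
    simp [mulVecEquiv_apply]
  map_mul' A B := by
    rw [mul_comm, ← MeasureTheory.addEquivAddHaarChar_trans]
    congr 1
    ext w : 1
    simp [mulVecEquiv_apply, Matrix.mulVec_mulVec]

theorem haar_convexBody (A : GL (Fin d) (Kinf F)) :
    haar F d (convexBody A) = (scaleHom F d A : NNReal) := by
  have h := MeasureTheory.addEquivAddHaarChar_smul_preimage (haar F d)
    (X := convexBody A) (mulVecEquiv A)
  have h2 : mulVecEquiv A ⁻¹' convexBody A = unitCube F d :=
    Set.preimage_image_eq _ (mulVecEquiv A).injective
  rw [h2, haar_unitCube] at h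
  rw [← h]
  simp [scaleHom, ENNReal.smul_def]

/-- A matrix that is integral together with its inverse maps the unit cube onto itself. -/
theorem scaleHom_eq_one {A : GL (Fin d) (Kinf F)} (h : ∀ i j, absv (A.1 i j) ≤ 1)
    (h' : ∀ i j, absv ((A⁻¹ : GL _ _).1 i j) ≤ 1) : scaleHom F d A = 1 := by
  have key : ∀ B : Matrix (Fin d) (Fin d) (Kinf F), (∀ i j, absv (B i j) ≤ 1) →
      ∀ w ∈ unitCube F d, B.mulVec w ∈ unitCube F d := by
    intro B hB w hw i
    change absv (∑ j, B i j * w j) ≤ 1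
    refine absv_sum_le _ _ zero_le_one fun j _ => ?_
    rw [absv_mul]
    exact mul_le_one₀ (hB i j) (absv_nonneg _) (hw j)
  have hc : convexBody A = unitCube F d := by
    ext w
    rw [mem_convexBody_iff, ← mem_unitCube_iff]
    refine ⟨fun hw => ?_, key _ h' w⟩
    simpa [Matrix.mulVec_mulVec] using key _ h _ hw
  have := haar_convexBody A
  rw [hc, haar_unitCube] at this
  exact_mod_cast this.symm

theorem mem_convexBody_diagGL {a : Fin d → (Kinf F)ˣ} {w : Fin d → Kinf F} :
    w ∈ convexBody (diagGL a) ↔ ∀ i, absv (w i) ≤ absv (a i : Kinf F) := by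
  rw [mem_convexBody_iff, ← map_inv, coe_diagGL, ← mem_unitCube_iff]
  refine forall_congr' fun i => ?_
  rw [Matrix.mulVec_diagonal, absv_mul, Pi.inv_apply, Units.val_inv_eq_inv_val, absv_inv,
    inv_mul_le_one₀ (absv_pos (a i).ne_zero)]

theorem absv_single_zero_le (c : F) : absv (HahnSeries.single (0 : ℤ) c : Kinf F) ≤ 1 := by
  have := (absv_le_zpow_iff (f := (HahnSeries.single (0 : ℤ) c : Kinf F)) (n := 0)).mpr
    fun m hm => HahnSeries.coeff_single_of_ne (by omega)
  simpa using this

/-- The inverse of `x` as a unit. -/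
def xInvUnit (F : Type*) [Field F] : (Kinf F)ˣ := (Units.mk0 (xElt F) xElt_ne_zero)⁻¹

theorem absv_xInvUnit : absv (xInvUnit F : Kinf F) = (Fintype.card F : ℝ)⁻¹ := by
  rw [xInvUnit, Units.val_inv_eq_inv_val, absv_inv, Units.val_mk0, absv_xElt]

theorem mem_convexBody_diagGL_mulSingle (i : Fin d) {w : Fin d → Kinf F} :
    w ∈ convexBody (diagGL (Pi.mulSingle i (xInvUnit F))) ↔
      w ∈ unitCube F d ∧ (w i).coeff 0 = 0 := by
  have hi : absv (w i) ≤ absv (xInvUnit F : Kinf F) ↔ absv (w i) ≤ 1 ∧ (w i).coeff 0 = 0 := by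
    have h1 : absv (xInvUnit F : Kinf F) = (Fintype.card F : ℝ) ^ (-1 : ℤ) := by
      rw [absv_xInvUnit, zpow_neg_one]
    have h2 := absv_le_zpow_iff (f := w i) (n := 0)
    rw [zpow_zero] at h2
    rw [h1, h2, absv_le_zpow_iff]
    constructor
    · exact fun h => ⟨fun m hm => h m (by omega), h 0 (by omega)⟩
    · rintro ⟨h, h'⟩ m hm
      rcases eq_or_ne m 0 with rfl | hm0
      · exact h'
      · exact h m (by omega)
  rw [mem_convexBody_diagGL]
  constructor
  · intro h
    have h0 := hi.mp (by simpa using h i)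
    refine ⟨fun j => ?_, h0.2⟩
    rcases eq_or_ne j i with rfl | hj
    · exact h0.1
    · simpa [hj] using h j
  · rintro ⟨h, h'⟩ j
    rcases eq_or_ne j i with rfl | hj
    · simpa using hi.mpr ⟨h j, h'⟩
    · simpa [hj] using h j

/-- The constant coefficient of the i-th coordinate splits the cube into q translates of its part
where that coefficient is 0, and this part is the cube shrunk by x⁻¹ in direction i. -/
theorem card_mul_scaleHom_mulSingle (i : Fin d) :
    (Fintype.card F : NNReal) * scaleHom F d (diagGL (Pi.mulSingle i (xInvUnit F))) = 1 := by
  set B := convexBody (diagGL (Pi.mulSingle i (xInvUnit F))) with hB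
  let e : F → Fin d → Kinf F := fun c => -Pi.single i (HahnSeries.single (0 : ℤ) c)
  let T : F → Set (Fin d → Kinf F) := fun c => (fun w => e c + w) ⁻¹' B
  have hT : ∀ c w, w ∈ T c ↔ w ∈ unitCube F d ∧ (w i).coeff 0 = c := by
    intro c w
    have h0 := absv_single_zero_le c
    have hc : ((e c + w) i).coeff 0 = (w i).coeff 0 - c := by
      simp [e, neg_add_eq_sub]
    have hcube : e c + w ∈ unitCube F d ↔ w ∈ unitCube F d := by
      refine forall_congr' fun j => ?_
      rcases eq_or_ne j i with rfl | hj
      · simp only [e, Pi.add_apply, Pi.neg_apply, Pi.single_eq_same]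
        constructor
        · intro h
          have := absv_add_le_max (HahnSeries.single (0 : ℤ) c) (-HahnSeries.single (0 : ℤ) c + w j)
          rw [add_neg_cancel_left] at this
          exact this.trans (max_le h0 h)
        · intro h
          exact (absv_add_le_max _ _).trans (max_le (by rwa [absv_neg]) h)
      · simp [e, hj]
    change e c + w ∈ B ↔ _
    rw [hB, mem_convexBody_diagGL_mulSingle, hcube, hc, sub_eq_zero]
  have hU : unitCube F d = ⋃ c, T c := by
    ext w
    simp [hT]
  have hm : ∀ c, haar F d (T c) = haar F d B := fun c =>
    MeasureTheory.measure_preimage_add _ _ _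
  have hd : Pairwise (Function.onFun Disjoint T) := fun c c' hcc =>
    Set.disjoint_left.mpr fun w hw hw' => hcc (((hT c w).mp hw).2.symm.trans ((hT c' w).mp hw').2)
  have ho : ∀ c, MeasurableSet (T c) := fun c =>
    ((isOpen_convexBody _).preimage (continuous_const.add continuous_id)).measurableSet
  have h1 := haar_unitCube F d
  rw [hU, MeasureTheory.measure_iUnion hd ho] at h1
  simp only [hm, tsum_fintype, Finset.sum_const, Finset.card_univ, nsmul_eq_mul, hB,
    haar_convexBody] at h1
  exact_mod_cast h1

/-- Every unit is a power of x times a unit of absolute value 1. The latter preserves the cube, and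
the factor of x⁻¹ is q⁻¹ by the count above. -/
theorem scaleHom_diagGL_mulSingle (i : Fin d) (u : (Kinf F)ˣ) :
    (scaleHom F d (diagGL (Pi.mulSingle i u)) : ℝ) = absv (u : Kinf F) := by
  obtain ⟨n, hn⟩ := exists_absv_eq_zpow u.ne_zero
  have hunit : ∀ u : (Kinf F)ˣ, absv (u : Kinf F) = 1 →
      scaleHom F d (diagGL (Pi.mulSingle i u)) = 1 := by
    intro u hu
    have aux : ∀ u : (Kinf F)ˣ, absv (u : Kinf F) = 1 →
        ∀ j k, absv ((diagGL (Pi.mulSingle i u)).1 j k) ≤ 1 := by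
      intro u hu j k
      rw [coe_diagGL, Matrix.diagonal_apply]
      split_ifs
      · rcases eq_or_ne j i with rfl | hj
        · simp [hu]
        · simp [hj]
      · simp
    refine scaleHom_eq_one (aux u hu) ?_
    rw [← map_inv, ← Pi.mulSingle_inv]
    exact aux _ (by rw [Units.val_inv_eq_inv_val, absv_inv, hu, inv_one])
  have hxs : (scaleHom F d (diagGL (Pi.mulSingle i (xInvUnit F))) : ℝ) = (Fintype.card F : ℝ)⁻¹ :=
    eq_inv_of_mul_eq_one_right (by exact_mod_cast card_mul_scaleHom_mulSingle (F := F) i)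
  let ψ : (Kinf F)ˣ →* NNReal :=
    (scaleHom F d).comp (diagGL.comp (MonoidHom.mulSingle (fun _ : Fin d => (Kinf F)ˣ) i))
  have hψ : ∀ u, ψ u = scaleHom F d (diagGL (Pi.mulSingle i u)) := fun _ => rfl
  have hv : absv ((u * xInvUnit F ^ n : (Kinf F)ˣ) : Kinf F) = 1 := by
    have : absv ((xInvUnit F : Kinf F) ^ n) = absv (xInvUnit F : Kinf F) ^ n :=
      map_zpow₀ (absvHom F) _ n
    rw [Units.val_mul, Units.val_zpow_eq_zpow_val, absv_mul, this, absv_xInvUnit, hn, inv_zpow,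
      mul_inv_cancel₀ (card_zpow_pos F n).ne']
  have h1 := hunit _ hv
  rw [← hψ, map_mul] at h1
  have h2 : ψ (xInvUnit F ^ n) = ψ (xInvUnit F) ^ n :=
    map_zpow' ψ (fun u => eq_inv_of_mul_eq_one_left (by rw [← map_mul, inv_mul_cancel, map_one])) _ _
  rw [h2] at h1
  have h3 : (ψ u : ℝ) * ((Fintype.card F : ℝ)⁻¹) ^ n = 1 := by
    rw [← hxs, ← hψ]; exact_mod_cast h1
  rw [← hψ, hn]
  rw [inv_zpow] at h3
  exact eq_of_mul_inv_eq_one h3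

theorem scaleHom_diagGL (a : Fin d → (Kinf F)ˣ) :
    (scaleHom F d (diagGL a) : ℝ) = ∏ i, absv (a i : Kinf F) := by
  have h : scaleHom F d (diagGL a) = ∏ i, scaleHom F d (diagGL (Pi.mulSingle i (a i))) := by
    conv_lhs => rw [← Finset.univ_prod_mulSingle a]
    exact map_prod ((scaleHom F d).comp diagGL) _ _
  rw [h, NNReal.coe_prod]
  exact Finset.prod_congr rfl fun i _ => scaleHom_diagGL_mulSingle i (a i)

/-- A transvection with c ≠ 0 is conjugate, by a diagonal matrix, to the one with parameter 1. The
latter preserves the cube, and conjugate matrices have the same factor because the target is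
commutative. -/
theorem scaleHom_transvection {A : GL (Fin d) (Kinf F)} {i j : Fin d} (hij : i ≠ j) {c : Kinf F}
    (hA : A.1 = Matrix.transvection i j c) : scaleHom F d A = 1 := by
  rcases eq_or_ne c 0 with rfl | hc
  · have : A = 1 := Units.ext (by simpa using hA)
    rw [this, map_one]
  · let T : Kinf F → GL (Fin d) (Kinf F) := fun c =>
      ⟨Matrix.transvection i j c, Matrix.transvection i j (-c),
        by rw [Matrix.transvection_mul_transvection_same _ _ hij]; simp,
        by rw [Matrix.transvection_mul_transvection_same _ _ hij]; simp⟩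
    have hT : ∀ (c : Kinf F) (k l : Fin d), absv c ≤ 1 → absv (Matrix.transvection i j c k l) ≤ 1 := by
      intro c k l h
      rw [Matrix.transvection, Matrix.add_apply, Matrix.one_apply, Matrix.single_apply]
      refine (absv_add_le_max _ _).trans (max_le ?_ ?_)
      · split_ifs <;> simp
      · split_ifs <;> simp [h]
    have h1 : scaleHom F d (T 1) = 1 :=
      scaleHom_eq_one (fun k l => hT 1 k l (by simp)) (fun k l => hT (-1) k l (by simp))
    let D : GL (Fin d) (Kinf F) := diagGL (Pi.mulSingle i (Units.mk0 c hc))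
    have h2 : D * T 1 = A * D := by
      apply Units.ext
      rw [Units.val_mul, Units.val_mul, hA]
      change Matrix.diagonal _ * Matrix.transvection i j 1 =
        Matrix.transvection i j c * Matrix.diagonal _
      ext k l
      rw [Matrix.diagonal_mul, Matrix.mul_diagonal, Matrix.transvection, Matrix.transvection]
      simp only [Matrix.add_apply, Matrix.one_apply, Matrix.single_apply]
      by_cases hki : i = k
      · subst hki
        by_cases hjl : j = l
        · subst hjl
          simp [hij, hij.symm]
        · by_cases hil : i = l
          · subst hil; simp [hjl]
          · simp [hjl, hil]
      · by_cases hkl : k = l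
        · subst hkl; simp [hki]
        · simp [hki, hkl]
    have h3 := congrArg (scaleHom F d) h2
    rw [map_mul, map_mul, h1, mul_comm] at h3
    have hD : scaleHom F d D ≠ 0 := ((Group.isUnit D).map (scaleHom F d)).ne_zero
    exact (mul_right_cancel₀ hD h3).symm

theorem scaleHom_eq_absv_det (A : GL (Fin d) (Kinf F)) :
    (scaleHom F d A : ℝ) = absv A.1.det := by
  refine Matrix.diagonal_transvection_induction_of_det_ne_zero
    (fun M => ∀ A : GL (Fin d) (Kinf F), A.1 = M → (scaleHom F d A : ℝ) = absv M.det) A.1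
    (Matrix.GeneralLinearGroup.det_ne_zero A) ?_ ?_ ?_ A rfl
  · intro D hD A hA
    rw [Matrix.det_diagonal] at hD ⊢
    have hD' : ∀ i, D i ≠ 0 := fun i => Finset.prod_ne_zero_iff.mp hD i (Finset.mem_univ i)
    obtain rfl : A = diagGL fun i => Units.mk0 (D i) (hD' i) := Units.ext (by rw [hA]; rfl)
    rw [scaleHom_diagGL, absv_prod]
    rfl
  · intro t A hA
    rw [scaleHom_transvection t.hij hA, Matrix.TransvectionStruct.det]
    simp
  · intro M M' hM hM' h h' A hA
    let B := Matrix.GeneralLinearGroup.mkOfDetNeZero M hM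
    let B' := Matrix.GeneralLinearGroup.mkOfDetNeZero M' hM'
    obtain rfl : A = B * B' := Units.ext hA
    rw [map_mul, NNReal.coe_mul, h B rfl, h' B' rfl, Matrix.det_mul, absv_mul]

/-- The volume of the convex body `A 𝒪^d` is `|det A|`. -/
theorem haar_convexBody_eq (A : GL (Fin d) (Kinf F)) :
    haar F d (convexBody A) = ENNReal.ofReal (absv A.1.det) := by
  rw [haar_convexBody, ← scaleHom_eq_absv_det, ENNReal.ofReal_coe_nnreal]

theorem vol_convexBody (A : GL (Fin d) (Kinf F)) : vol (convexBody A) = absv A.1.det := by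
  rw [vol, haar_convexBody_eq, ENNReal.toReal_ofReal (absv_nonneg _)]

end Volume

/-! ### Fundamental domains and Minkowski's second theorem. -/

section Lattice

attribute [local instance] borelSpaceKinf borelSpace_kinf locallyCompactSpace_kinf

variable {F : Type*} [Field F] {d : ℕ}

theorem mem_lattice_iff {A : GL (Fin d) (Kinf F)} {w : Fin d → Kinf F} :
    w ∈ lattice A ↔ ∀ i, (A⁻¹ : GL _ _).1.mulVec w i ∈ Set.range (polyEmb F) := by
  constructor
  · rintro ⟨P, rfl⟩ i
    exact ⟨P i, by simp [Matrix.mulVec_mulVec]⟩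
  · intro h
    choose P hP using h
    refine ⟨P, ?_⟩
    simp only [hP]
    simp [Matrix.mulVec_mulVec]

/-- The lattice `A R^d` as an additive subgroup. -/
def latticeSubgroup (A : GL (Fin d) (Kinf F)) : AddSubgroup (Fin d → Kinf F) where
  carrier := lattice A
  zero_mem' := ⟨0, by simp [← Pi.zero_def]⟩
  add_mem' := by
    rintro _ _ ⟨P, rfl⟩ ⟨Q, rfl⟩
    refine ⟨P + Q, ?_⟩
    simp only [Pi.add_apply, map_add, ← Matrix.mulVec_add]
    rfl
  neg_mem' := by
    rintro _ ⟨P, rfl⟩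
    refine ⟨-P, ?_⟩
    simp only [Pi.neg_apply, map_neg, ← Matrix.mulVec_neg]
    rfl

theorem polyEmb_smul_mem_lattice {A : GL (Fin d) (Kinf F)} (P : F[X]) {w : Fin d → Kinf F}
    (hw : w ∈ lattice A) : polyEmb F P • w ∈ lattice A := by
  obtain ⟨Q, rfl⟩ := hw
  refine ⟨fun i => P * Q i, ?_⟩
  simp only [map_mul, ← Matrix.mulVec_smul]
  rfl

variable [Fintype F]

theorem mem_convexBody_mul {A B : GL (Fin d) (Kinf F)} {w : Fin d → Kinf F} :
    w ∈ convexBody (A * B) ↔ (A⁻¹ : GL _ _).1.mulVec w ∈ convexBody B := by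
  rw [mem_convexBody_iff, mem_convexBody_iff, mul_inv_rev, Units.val_mul, Matrix.mulVec_mulVec]

theorem sub_mem_convexBody {M : GL (Fin d) (Kinf F)} {v w : Fin d → Kinf F}
    (hv : v ∈ convexBody M) (hw : w ∈ convexBody M) : v - w ∈ convexBody M := by
  rw [mem_convexBody_iff] at *
  rw [Matrix.mulVec_sub]
  exact (supNorm_sub_le _ _).trans (max_le hv hw)

theorem countable_latticeSubgroup (A : GL (Fin d) (Kinf F)) : Countable (latticeSubgroup A) := by
  have : Countable F[X] := Cardinal.mk_le_aleph0_iff.mp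
    (Polynomial.cardinalMk_le_max.trans (max_le (Cardinal.mk_le_aleph0 (α := F)) le_rfl))
  exact (Set.countable_range _).to_subtype

attribute [local instance] countable_latticeSubgroup

/-- A fundamental domain of the lattice `A R^d`. -/
def latticeDomain (A : GL (Fin d) (Kinf F)) : Set (Fin d → Kinf F) :=
  convexBody (A * diagGL fun _ => xInvUnit F)

theorem mem_latticeDomain {A : GL (Fin d) (Kinf F)} {w : Fin d → Kinf F} :
    w ∈ latticeDomain A ↔ ∀ i, absv ((A⁻¹ : GL _ _).1.mulVec w i) < 1 := by
  rw [latticeDomain, mem_convexBody_mul, mem_convexBody_diagGL]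
  refine forall_congr' fun i => ?_
  rw [absv_xInvUnit]
  have := absv_lt_zpow_iff (f := (A⁻¹ : GL _ _).1.mulVec w i) (n := 0)
  simpa using this.symm

/-- In the coordinates of `A` the domain consists of the vectors with entries of absolute value
below 1; every coordinate is uniquely a polynomial plus a fractional part. -/
theorem isAddFundamentalDomain_latticeDomain (A : GL (Fin d) (Kinf F)) :
    MeasureTheory.IsAddFundamentalDomain (latticeSubgroup A) (latticeDomain A) (haar F d) := by
  refine MeasureTheory.IsAddFundamentalDomain.mk'
    (isOpen_convexBody _).measurableSet.nullMeasurableSet fun w => ?_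
  set y := (A⁻¹ : GL _ _).1.mulVec w with hy
  choose P hP using fun i => exists_polyEmb_eq_sub_frac (y i)
  have hg : A.1.mulVec (fun i => polyEmb F (-P i)) ∈ latticeSubgroup A := ⟨fun i => -P i, rfl⟩
  refine ⟨⟨_, hg⟩, mem_latticeDomain.mpr fun i => ?_, fun g' hg' => ?_⟩
  · change absv ((A⁻¹ : GL _ _).1.mulVec (_ + w) i) < 1
    rw [Matrix.mulVec_add, ← hy]
    simpa [Matrix.mulVec_mulVec, hP] using absv_frac_lt_one (y i)
  · obtain ⟨_, Q, rfl⟩ := g'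
    apply Subtype.ext
    change A.1.mulVec (fun i => polyEmb F (Q i)) = A.1.mulVec (fun i => polyEmb F (-P i))
    congr 1
    funext i
    have h1 := mem_latticeDomain.mp hg' i
    change absv ((A⁻¹ : GL _ _).1.mulVec (_ + w) i) < 1 at h1
    rw [Matrix.mulVec_add, ← hy] at h1
    simp only [Matrix.mulVec_mulVec, Units.inv_mul, Matrix.one_mulVec, Pi.add_apply] at h1
    have h2 : absv (polyEmb F (Q i + P i)) < 1 := by
      have := absv_sub_le_max (polyEmb F (Q i) + y i) (frac (y i))
      rw [add_sub_assoc, ← hP, ← map_add] at this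
      exact this.trans_lt (max_lt h1 (absv_frac_lt_one _))
    have h3 : Q i + P i = 0 := by
      by_contra h
      exact h2.not_ge (one_le_absv_polyEmb h)
    rw [eq_neg_of_add_eq_zero_left h3]

theorem absv_det_mul_diagGL (A : GL (Fin d) (Kinf F)) (a : Fin d → (Kinf F)ˣ) :
    absv (A * diagGL a).1.det = absv A.1.det * ∏ i, absv (a i : Kinf F) := by
  rw [Units.val_mul, Matrix.det_mul, absv_mul, coe_diagGL, Matrix.det_diagonal, absv_prod]

/-- A body `M 𝒪^d` that meets a group `L`, which contains the lattice `A R^d`, only in `0`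
is small. The finite set `T` consists of representatives of distinct cosets of the lattice. -/
theorem card_mul_absv_det_le {A M : GL (Fin d) (Kinf F)} {L : AddSubgroup (Fin d → Kinf F)}
    (hL : latticeSubgroup A ≤ L) {T : Finset (Fin d → Kinf F)} (hT : ∀ t ∈ T, t ∈ L)
    (hinj : ∀ t ∈ T, ∀ t' ∈ T, t - t' ∈ lattice A → t = t')
    (hM : ∀ y ∈ L, y ∈ convexBody M → y = 0) :
    (T.card : ℝ) * absv M.1.det ≤ absv A.1.det * ((Fintype.card F : ℝ)⁻¹) ^ d := by
  let s : Set (Fin d → Kinf F) := ⋃ t ∈ T, (fun w => -t + w) ⁻¹' convexBody M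
  have hopen : ∀ t : Fin d → Kinf F, IsOpen ((fun w => -t + w) ⁻¹' convexBody M) := fun t =>
    (isOpen_convexBody _).preimage (continuous_const.add continuous_id)
  have hs : haar F d s = ENNReal.ofReal (T.card * absv M.1.det) := by
    rw [MeasureTheory.measure_biUnion_finset _ fun t _ => (hopen t).measurableSet]
    · simp only [MeasureTheory.measure_preimage_add, haar_convexBody_eq, Finset.sum_const,
        nsmul_eq_mul]
      rw [ENNReal.ofReal_mul (Nat.cast_nonneg _), ENNReal.ofReal_natCast]
    -- A common point of two translates would put t - t' in the body, which is a group, hence in its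
    -- trivial intersection with L.
    · intro t ht t' ht' htt
      refine Set.disjoint_left.mpr fun w hw hw' => htt ?_
      have h0 := hM (t - t') (L.sub_mem (hT t ht) (hT t' ht'))
        (by simpa [neg_add_eq_sub] using sub_mem_convexBody hw' hw)
      exact sub_eq_zero.mp h0
  have hD : haar F d (latticeDomain A) =
      ENNReal.ofReal (absv A.1.det * ((Fintype.card F : ℝ)⁻¹) ^ d) := by
    rw [latticeDomain, haar_convexBody_eq, absv_det_mul_diagGL]
    simp [absv_xInvUnit]
  by_contra! hlt
  have hpos : 0 < (T.card : ℝ) * absv M.1.det :=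
    lt_of_le_of_lt (mul_nonneg (absv_nonneg _) (by positivity)) hlt
  -- Blichfeldt's principle: a union larger than the fundamental domain overlaps one of its
  -- translates by a nonzero lattice vector.
  obtain ⟨x, y, hxy, hdis⟩ := MeasureTheory.exists_pair_mem_lattice_not_disjoint_vadd
    (isAddFundamentalDomain_latticeDomain A) (s := s)
    (isOpen_biUnion fun t _ => hopen t).measurableSet.nullMeasurableSet
    (by rw [hD, hs]; exact (ENNReal.ofReal_lt_ofReal_iff hpos).mpr hlt)
  obtain ⟨z, ⟨a, ha, haz⟩, ⟨b, hb, hbz⟩⟩ := Set.not_disjoint_iff.mp hdis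
  obtain ⟨t, ht, hat⟩ := Set.mem_iUnion₂.mp ha
  obtain ⟨t', ht', hbt⟩ := Set.mem_iUnion₂.mp hb
  have hab : (x : Fin d → Kinf F) + a = y + b := haz.trans hbz.symm
  have he : (-t + a) - (-t' + b) = (t' - t) + ((y : Fin d → Kinf F) - x) := by
    rw [eq_sub_of_add_eq' hab]; abel
  -- The overlap yields a vector of L in the body, so it is 0. Then t' - t is a lattice vector,
  -- whence t' = t and x = y, a contradiction.
  have h0 := hM ((-t + a) - (-t' + b))
    (he ▸ L.add_mem (L.sub_mem (hT t' ht') (hT t ht)) (hL (sub_mem y.2 x.2)))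
    (sub_mem_convexBody hat hbt)
  rw [he] at h0
  have htt : t' = t := hinj t' ht' t ht (by
    rw [eq_neg_of_add_eq_zero_left h0, neg_sub]
    exact (latticeSubgroup A).sub_mem x.2 y.2)
  rw [htt, sub_self, zero_add, sub_eq_zero] at h0
  exact hxy (Subtype.ext h0.symm)

/-- The upper bound in Minkowski's second theorem, for a group `L` which contains the lattice
`A R^d`; the finite set `T` consists of representatives of distinct cosets of the lattice. -/
theorem card_mul_prod_zpow_le {A : GL (Fin d) (Kinf F)} {L : AddSubgroup (Fin d → Kinf F)}
    (hL : latticeSubgroup A ≤ L) {T : Finset (Fin d → Kinf F)} (hT : ∀ t ∈ T, t ∈ L)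
    (hinj : ∀ t ∈ T, ∀ t' ∈ T, t - t' ∈ lattice A → t = t')
    {w : Fin d → Fin d → Kinf F} (hw : LinearIndependent (Kinf F) w) {l : Fin d → ℤ}
    (hl : Monotone l) (hflag : ∀ i, ∀ y ∈ L, supNorm y < (Fintype.card F : ℝ) ^ l i →
      y ∈ Submodule.span (Kinf F) (w '' Set.Iio i)) :
    (T.card : ℝ) * ∏ i, (Fintype.card F : ℝ) ^ l i ≤ absv A.1.det := by
  classical
  obtain ⟨u, p, hu⟩ := exists_isEchelonAt hw
  have hdet := absv_det_of_isEchelonAt hu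
  let U : GL (Fin d) (Kinf F) := Matrix.GeneralLinearGroup.mkOfDetNeZero (Matrix.of u).transpose
    (fun h => by rw [Matrix.det_transpose] at h; simp [h] at hdet)
  have hUdet : absv U.1.det = 1 := by
    change absv (Matrix.of u).transpose.det = 1
    rwa [Matrix.det_transpose]
  -- q^(l_i - 1) is the largest value of the norm below q^(l_i), so the body with these sides still
  -- avoids nonzero vectors of L.
  let D : Fin d → (Kinf F)ˣ := fun i => Units.mk0 (xElt F ^ (l i - 1)) (zpow_ne_zero _ xElt_ne_zero)
  have hD : ∀ i, absv (D i : Kinf F) = (Fintype.card F : ℝ) ^ (l i - 1) := fun i =>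
    absv_xElt_zpow _
  have hq : (0 : ℝ) < Fintype.card F := zero_lt_one.trans (one_lt_card_real F)
  have h := card_mul_absv_det_le (M := U * diagGL D) hL hT hinj fun y hyL hy => by
    rw [mem_convexBody_mul, mem_convexBody_diagGL] at hy
    simp only [hD] at hy
    set c := (U⁻¹ : GL _ _).1.mulVec y with hc
    have hyc : y = ∑ i, c i • u i := by
      have : y = U.1.mulVec c := by simp [hc, Matrix.mulVec_mulVec]
      rw [this]
      ext k
      simp [U, Matrix.mulVec, dotProduct, mul_comm]
    by_contra hy0
    have hne : (Finset.univ.filter fun i => c i ≠ 0).Nonempty := by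
      by_contra hemp
      rw [Finset.not_nonempty_iff_eq_empty, Finset.filter_eq_empty_iff] at hemp
      refine hy0 (hyc.trans (Finset.sum_eq_zero fun i hi => ?_))
      rw [not_not.mp (hemp hi), zero_smul]
    -- Let i be the last index with c_i ≠ 0. As l is monotone, ‖y‖ < q^(l_i), so y lies in the span
    -- of the w_j with j < i; then so does u_i, which is excluded.
    obtain ⟨i, hi, hmax⟩ := Finset.exists_max_image _ id hne
    have hi0 : c i ≠ 0 := by simpa using hi
    have hgt : ∀ j, i < j → c j = 0 := fun j hj => by
      by_contra hj0
      exact hj.not_ge (hmax j (Finset.mem_filter.mpr ⟨Finset.mem_univ j, hj0⟩))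
    have hnorm : supNorm y < (Fintype.card F : ℝ) ^ l i := by
      refine lt_of_le_of_lt (b := (Fintype.card F : ℝ) ^ (l i - 1)) ?_
        (zpow_lt_zpow_right₀ (one_lt_card_real F) (by omega))
      rw [hyc]
      refine supNorm_sum_le _ _ (card_zpow_pos F _).le fun j _ => ?_
      rcases le_or_gt j i with hj | hj
      · rw [supNorm_smul]
        refine (mul_le_of_le_one_right (absv_nonneg _) (hu j).norm_le).trans ((hy j).trans ?_)
        exact zpow_le_zpow_right₀ (one_lt_card_real F).le (by have := hl hj; omega)
      · rw [hgt j hj, zero_smul, supNorm_zero]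
        exact (card_zpow_pos F _).le
    have hspan := hflag i y hyL hnorm
    rw [hyc, ← Finset.add_sum_erase _ _ (Finset.mem_univ i)] at hspan
    have hrest : ∑ j ∈ Finset.univ.erase i, c j • u j ∈
        Submodule.span (Kinf F) (w '' Set.Iio i) := by
      refine Submodule.sum_mem _ fun j hj => ?_
      rcases lt_or_gt_of_ne (Finset.ne_of_mem_erase hj) with h | h
      · refine Submodule.smul_mem _ _ (Submodule.span_mono (Set.image_mono ?_) (hu j).mem)
        exact fun k (hk : k ≤ j) => lt_of_le_of_lt hk h
      · rw [hgt j h, zero_smul]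
        exact zero_mem _
    exact (hu i).notMem ((Submodule.smul_mem_iff _ hi0).mp
      ((Submodule.add_mem_iff_left _ hrest).mp hspan))
  -- The factor q^(-d) from the sides of the body cancels the one in the volume of the fundamental
  -- domain.
  rw [absv_det_mul_diagGL, hUdet, one_mul] at h
  simp only [hD, zpow_sub_one₀ hq.ne', Finset.prod_mul_distrib, Finset.prod_const,
    Finset.card_univ, Fintype.card_fin] at h
  rw [← mul_assoc] at h
  exact le_of_mul_le_mul_right h (by positivity)

end Lattice

/-! ### Successive minima for the maximum norm. -/

section Minima

variable {F : Type*} [Field F] {d : ℕ}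

theorem linearIndependent_col (A : GL (Fin d) (Kinf F)) :
    LinearIndependent (Kinf F) A.1.transpose :=
  Matrix.linearIndependent_rows_of_det_ne_zero
    (by rw [Matrix.det_transpose]; exact Matrix.GeneralLinearGroup.det_ne_zero A)

theorem col_mem_lattice (A : GL (Fin d) (Kinf F)) (i : Fin d) : A.1.transpose i ∈ lattice A := by
  refine ⟨Pi.single i 1, ?_⟩
  have : (fun j => polyEmb F ((Pi.single i 1 : Fin d → F[X]) j)) = Pi.single i 1 := by
    ext1 j
    rcases eq_or_ne j i with rfl | h
    · simp
    · simp [h]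
  simp only [this, Matrix.mulVec_single_one]
  rfl

variable [Fintype F]

/-- The closed ball of radius `r` for the maximum norm. -/
def normBall (F : Type*) [Field F] [Fintype F] (d : ℕ) (r : ℝ) : Set (Fin d → Kinf F) :=
  {w | supNorm w ≤ r}

/-- The radii at which a set spans at least `i` dimensions, for the maximum norm. -/
def normRadii (S : Set (Fin d → Kinf F)) (i : ℕ) : Set ℝ :=
  {r : ℝ | 0 < r ∧ i ≤ Module.finrank (Kinf F) (Submodule.span (Kinf F) (S ∩ normBall F d r))}

/-- The successive minima for the maximum norm. -/
def normMin (S : Set (Fin d → Kinf F)) (i : ℕ) : ℝ := sInf (normRadii S i)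

theorem minimaRadii_convexBody (h : GL (Fin d) (Kinf F)) (S : Set (Fin d → Kinf F)) (i : ℕ) :
    minimaRadii (convexBody h) S i = normRadii ((h⁻¹ : GL _ _).1.mulVec '' S) i := by
  let e : (Fin d → Kinf F) ≃ₗ[Kinf F] (Fin d → Kinf F) :=
    { (h⁻¹ : GL _ _).1.mulVecLin with
      invFun := h.1.mulVec
      left_inv := fun w => by simp [Matrix.mulVec_mulVec]
      right_inv := fun w => by simp [Matrix.mulVec_mulVec] }
  have he : ∀ w, e w = (h⁻¹ : GL _ _).1.mulVec w := fun _ => rfl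
  ext r
  refine and_congr_right fun _ => ?_
  have himg : ((h⁻¹ : GL _ _).1.mulVec '' S) ∩ normBall F d r =
      e '' (S ∩ {w | bodyNorm (convexBody h) w ≤ r}) := by
    ext y
    constructor
    · rintro ⟨⟨w, hw, rfl⟩, hy⟩
      exact ⟨w, ⟨hw, by rw [Set.mem_ofPred_eq, bodyNorm_convexBody]; exact hy⟩, rfl⟩
    · rintro ⟨w, ⟨hw, hy⟩, rfl⟩
      rw [Set.mem_ofPred_eq, bodyNorm_convexBody] at hy
      exact ⟨⟨w, hw, rfl⟩, hy⟩
  have hspan : Submodule.span (Kinf F) (((h⁻¹ : GL _ _).1.mulVec '' S) ∩ normBall F d r) =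
      (Submodule.span (Kinf F) (S ∩ {w | bodyNorm (convexBody h) w ≤ r})).map
        (e : (Fin d → Kinf F) →ₗ[Kinf F] (Fin d → Kinf F)) := by
    rw [himg, Submodule.map_span]
    rfl
  rw [hspan, LinearEquiv.finrank_map_eq]

theorem succMin_convexBody (h : GL (Fin d) (Kinf F)) (S : Set (Fin d → Kinf F)) (i : ℕ) :
    succMin (convexBody h) S i = normMin ((h⁻¹ : GL _ _).1.mulVec '' S) i := by
  rw [succMin, minimaRadii_convexBody, normMin]

theorem normRadii_anti (S : Set (Fin d → Kinf F)) {i j : ℕ} (hij : i ≤ j) :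
    normRadii S j ⊆ normRadii S i := fun _ hr => ⟨hr.1, hij.trans hr.2⟩

theorem mem_normRadii_of_linearIndependent {S : Set (Fin d → Kinf F)} {n : ℕ}
    {w : Fin n → Fin d → Kinf F} (hw : LinearIndependent (Kinf F) w) (hS : ∀ i, w i ∈ S) {r : ℝ}
    (hr : 0 < r) (hwr : ∀ i, supNorm (w i) ≤ r) : r ∈ normRadii S n := by
  refine ⟨hr, ?_⟩
  have h1 := finrank_span_eq_card hw
  rw [Fintype.card_fin] at h1
  rw [← h1]
  exact Submodule.finrank_mono (Submodule.span_mono (Set.range_subset_iff.mpr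
    fun i => ⟨hS i, hwr i⟩))

theorem exists_le_zpow (F : Type*) [Field F] [Fintype F] (r : ℝ) :
    ∃ n : ℤ, r ≤ (Fintype.card F : ℝ) ^ n := by
  obtain ⟨n, hn⟩ := pow_unbounded_of_one_lt r (one_lt_card_real F)
  exact ⟨n, by simpa using hn.le⟩

theorem supNorm_le_zpow_of_lt {w : Fin d → Kinf F} {n : ℤ}
    (h : supNorm w < (Fintype.card F : ℝ) ^ (n + 1)) : supNorm w ≤ (Fintype.card F : ℝ) ^ n := by
  by_cases hw : w = 0
  · rw [hw, supNorm_zero]; exact (card_zpow_pos F n).le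
  · obtain ⟨m, hm⟩ := exists_supNorm_eq_zpow hw
    rw [hm] at h ⊢
    rw [zpow_lt_zpow_iff_right₀ (one_lt_card_real F)] at h
    exact zpow_le_zpow_right₀ (one_lt_card_real F).le (by omega)

theorem exists_isLeast_normRadii {S : Set (Fin d → Kinf F)} {ε : ℝ} (hε : 0 < ε)
    (hS : ∀ y ∈ S, y ≠ 0 → ε ≤ supNorm y) {w : Fin d → Fin d → Kinf F}
    (hw : LinearIndependent (Kinf F) w) (hwS : ∀ i, w i ∈ S) {i : ℕ} (hi : 1 ≤ i) (hid : i ≤ d) :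
    ∃ n : ℤ, IsLeast (normRadii S i) ((Fintype.card F : ℝ) ^ n) := by
  have hne : ∃ n : ℤ, (Fintype.card F : ℝ) ^ n ∈ normRadii S i := by
    obtain ⟨n, hn⟩ := exists_le_zpow F (∑ i, supNorm (w i))
    exact ⟨n, normRadii_anti S hid (mem_normRadii_of_linearIndependent hw hwS (card_zpow_pos F n)
      fun i => (Finset.single_le_sum (fun j _ => supNorm_nonneg (w j)) (Finset.mem_univ i)).trans hn)⟩
  have hlow : ∀ r ∈ normRadii S i, ε ≤ r := by
    intro r hr
    by_contra! hlt
    have hsub : S ∩ normBall F d r ⊆ {0} := fun y hy => by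
      by_contra hy0
      exact (hlt.trans_le (hS y hy.1 hy0)).not_ge hy.2
    have h0 : Submodule.span (Kinf F) (S ∩ normBall F d r) = ⊥ := by
      rw [eq_bot_iff, ← Submodule.span_zero_singleton (Kinf F)]
      exact Submodule.span_mono hsub
    have := hr.2
    rw [h0, finrank_bot] at this
    omega
  obtain ⟨b, hb⟩ := exists_le_zpow F ε⁻¹
  have hbound : ∀ n : ℤ, (Fintype.card F : ℝ) ^ n ∈ normRadii S i → -b ≤ n := by
    intro n hn
    have h1 := hlow _ hn
    rw [← zpow_le_zpow_iff_right₀ (one_lt_card_real F), zpow_neg]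
    exact (inv_le_of_inv_le₀ hε hb).trans h1
  obtain ⟨n, hn, hmin⟩ := Int.exists_least_of_bdd ⟨-b, hbound⟩ hne
  refine ⟨n, hn, fun r hr => ?_⟩
  -- Rounding r down to a power of q loses no point of the ball.
  obtain ⟨m, hm1, hm2⟩ := exists_mem_Ico_zpow hr.1 (one_lt_card_real F)
  refine (zpow_le_zpow_right₀ (one_lt_card_real F).le (hmin m ⟨card_zpow_pos F m, ?_⟩)).trans hm1
  refine hr.2.trans (Submodule.finrank_mono (Submodule.span_mono fun y hy => ⟨hy.1, ?_⟩))
  exact supNorm_le_zpow_of_lt (lt_of_le_of_lt hy.2 hm2)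

/-- Greedy choice: n vectors cannot span all points within the radius `r (n + 1)`, which span
dimension at least n + 1. -/
theorem exists_linearIndependent_of_normRadii {S : Set (Fin d → Kinf F)} (r : ℕ → ℝ) (n : ℕ)
    (hr : ∀ i, 1 ≤ i → i ≤ n → r i ∈ normRadii S i) :
    ∃ w : Fin n → Fin d → Kinf F, LinearIndependent (Kinf F) w ∧
      ∀ i, w i ∈ S ∧ supNorm (w i) ≤ r (i + 1) := by
  induction n with
  | zero => exact ⟨Fin.elim0, linearIndependent_empty_type, fun i => i.elim0⟩
  | succ n ih =>
    obtain ⟨w, hw, hwS⟩ := ih fun i h1 h2 => hr i h1 (by omega)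
    have hlt : ¬ S ∩ normBall F d (r (n + 1)) ⊆ Submodule.span (Kinf F) (Set.range w) := by
      intro hsub
      have h1 := (hr (n + 1) (by omega) le_rfl).2.trans
        (Submodule.finrank_mono (Submodule.span_le.mpr hsub))
      rw [finrank_span_eq_card hw, Fintype.card_fin] at h1
      omega
    obtain ⟨y, hy, hyn⟩ := Set.not_subset.mp hlt
    refine ⟨Fin.snoc w y, hw.finSnoc hyn, fun i => ?_⟩
    refine Fin.lastCases ?_ (fun i => ?_) i
    · simpa using show y ∈ S ∧ supNorm y ≤ r (n + 1) from hy
    · simpa using hwS i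

/-- The points of `S` of norm at most ‖y‖ span a space of some dimension k ≤ i. The first k vectors
of `w` are among them, hence form a basis of that space. -/
theorem mem_span_of_supNorm_lt_normMin {S : Set (Fin d → Kinf F)} {w : Fin d → Fin d → Kinf F}
    (hbdd : ∀ i, BddBelow (normRadii S i))
    (hw : LinearIndependent (Kinf F) w)
    (hwS : ∀ i, w i ∈ S ∧ supNorm (w i) ≤ normMin S (i + 1)) (i : Fin d) {y : Fin d → Kinf F}
    (hy : y ∈ S) (hlt : supNorm y < normMin S (i + 1)) :
    y ∈ Submodule.span (Kinf F) (w '' Set.Iio i) := by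
  by_cases hy0 : y = 0
  · rw [hy0]; exact zero_mem _
  set W := Submodule.span (Kinf F) (S ∩ normBall F d (supNorm y)) with hW
  set k := Module.finrank (Kinf F) W with hk
  have hki : k ≤ i := by
    by_contra! h
    exact hlt.not_ge (csInf_le (hbdd _) ⟨supNorm_pos hy0, h⟩)
  have hyW : y ∈ W := Submodule.subset_span ⟨hy, show supNorm y ≤ supNorm y from le_rfl⟩
  have hkd : k ≤ d := hki.trans i.2.le
  let w' : Fin k → Fin d → Kinf F := fun j => w (Fin.castLE hkd j)
  have hw' : LinearIndependent (Kinf F) w' := hw.comp _ (Fin.castLE_injective hkd)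
  have hle : Submodule.span (Kinf F) (Set.range w') ≤ W := by
    refine Submodule.span_mono (Set.range_subset_iff.mpr fun j => ⟨(hwS _).1, ?_⟩)
    refine (hwS _).2.trans (csInf_le (hbdd _) ⟨supNorm_pos hy0, ?_⟩)
    exact j.2
  have heq : Submodule.span (Kinf F) (Set.range w') = W :=
    Submodule.eq_of_le_of_finrank_eq hle (by rw [finrank_span_eq_card hw', Fintype.card_fin])
  rw [← heq] at hyW
  refine Submodule.span_mono ?_ hyW
  rintro _ ⟨j, rfl⟩
  exact ⟨Fin.castLE hkd j, Fin.lt_def.mpr (lt_of_lt_of_le j.2 hki), rfl⟩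

theorem exists_supNorm_mulVec_le (B : Matrix (Fin d) (Fin d) (Kinf F)) :
    ∃ C : ℝ, 0 < C ∧ ∀ y, supNorm (B.mulVec y) ≤ C * supNorm y := by
  have hpos : 0 ≤ ∑ i, supNorm (B i) := Finset.sum_nonneg fun i _ => supNorm_nonneg _
  refine ⟨1 + ∑ i, supNorm (B i), by positivity, fun y => ?_⟩
  have hC := mul_nonneg (by positivity : 0 ≤ 1 + ∑ i, supNorm (B i)) (supNorm_nonneg y)
  refine (supNorm_le_iff hC).mpr fun i => ?_
  change absv (∑ j, B i j * y j) ≤ _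
  refine absv_sum_le _ _ hC fun j _ => ?_
  rw [absv_mul]
  refine mul_le_mul ?_ (absv_le_supNorm y j) (absv_nonneg _) (by positivity)
  refine (absv_le_supNorm (B i) j).trans ?_
  have := Finset.single_le_sum (fun k _ => supNorm_nonneg (B k)) (Finset.mem_univ i)
  linarith

theorem exists_le_supNorm_of_mem_lattice (A : GL (Fin d) (Kinf F)) :
    ∃ ε : ℝ, 0 < ε ∧ ∀ y ∈ lattice A, y ≠ 0 → ε ≤ supNorm y := by
  obtain ⟨C, hC, hle⟩ := exists_supNorm_mulVec_le (A⁻¹ : GL _ _).1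
  refine ⟨C⁻¹, inv_pos.mpr hC, fun y hy hy0 => ?_⟩
  have hz0 : (A⁻¹ : GL _ _).1.mulVec y ≠ 0 := fun h => hy0 (by
    have := congrArg A.1.mulVec h
    simpa [Matrix.mulVec_mulVec] using this)
  obtain ⟨i, hi⟩ := Function.ne_iff.mp hz0
  obtain ⟨P, hP⟩ := mem_lattice_iff.mp hy i
  have hP0 : P ≠ 0 := fun h => hi (by rw [← hP, h, map_zero]; rfl)
  have h1 := (one_le_absv_polyEmb hP0).trans
    (hP.symm ▸ absv_le_supNorm ((A⁻¹ : GL _ _).1.mulVec y) i : _ ≤ supNorm ((A⁻¹ : GL _ _).1.mulVec y))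
  exact (inv_le_iff_one_le_mul₀' hC).mpr (h1.trans (hle y))

/-- Two points of one coset, both shorter than the shortest nonzero lattice vector, coincide by the
ultrametric inequality. So there are at most as many short points as cosets. -/
theorem exists_le_supNorm_of_mem {A : GL (Fin d) (Kinf F)} {L : AddSubgroup (Fin d → Kinf F)}
    {T : Finset (Fin d → Kinf F)} (hcover : ∀ y ∈ L, ∃ t ∈ T, y - t ∈ lattice A) :
    ∃ ε : ℝ, 0 < ε ∧ ∀ y ∈ L, y ≠ 0 → ε ≤ supNorm y := by
  obtain ⟨ε, hε, hlow⟩ := exists_le_supNorm_of_mem_lattice A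
  choose! t ht hty using hcover
  have hfin : {y | y ∈ L ∧ y ≠ 0 ∧ supNorm y < ε}.Finite := by
    refine Set.Finite.of_injOn (f := t) (t := T) (fun y hy => ht y hy.1) ?_ T.finite_toSet
    intro y hy y' hy' h
    by_contra hne
    have h1 : y - y' ∈ lattice A := by
      have := (latticeSubgroup A).sub_mem (hty y hy.1) (hty y' hy'.1)
      rwa [h, sub_sub_sub_cancel_right] at this
    exact ((supNorm_sub_le y y').trans_lt (max_lt hy.2.2 hy'.2.2)).not_ge
      (hlow _ h1 (sub_ne_zero.mpr hne))
  rcases Set.eq_empty_or_nonempty {y | y ∈ L ∧ y ≠ 0 ∧ supNorm y < ε} with h | h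
  · refine ⟨ε, hε, fun y hy hy0 => ?_⟩
    by_contra! hlt
    exact (h ▸ (⟨hy, hy0, hlt⟩ : y ∈ {y | y ∈ L ∧ y ≠ 0 ∧ supNorm y < ε}) : y ∈ (∅ : Set _))
  · obtain ⟨z, hz, hmin⟩ := Set.exists_min_image _ supNorm hfin h
    refine ⟨supNorm z, supNorm_pos hz.2.1, fun y hy hy0 => ?_⟩
    rcases lt_or_ge (supNorm y) ε with hlt | hge
    · exact hmin y ⟨hy, hy0, hlt⟩
    · exact hz.2.2.le.trans hge

theorem bddBelow_normRadii (S : Set (Fin d → Kinf F)) (i : ℕ) : BddBelow (normRadii S i) :=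
  ⟨0, fun _ hr => hr.1.le⟩

theorem isLeast_normRadii {A : GL (Fin d) (Kinf F)} {L : AddSubgroup (Fin d → Kinf F)}
    (hL : latticeSubgroup A ≤ L) {T : Finset (Fin d → Kinf F)}
    (hcover : ∀ y ∈ L, ∃ t ∈ T, y - t ∈ lattice A) {i : ℕ} (hi : 1 ≤ i) (hid : i ≤ d) :
    IsLeast (normRadii (L : Set (Fin d → Kinf F)) i)
      (normMin (L : Set (Fin d → Kinf F)) i) ∧
      ∃ n : ℤ, normMin (L : Set (Fin d → Kinf F)) i = (Fintype.card F : ℝ) ^ n := by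
  obtain ⟨ε, hε, hlow⟩ := exists_le_supNorm_of_mem hcover
  obtain ⟨n, hn⟩ := exists_isLeast_normRadii hε hlow (linearIndependent_col A)
    (fun i => hL (col_mem_lattice A i)) hi hid
  have : normMin (L : Set (Fin d → Kinf F)) i = (Fintype.card F : ℝ) ^ n := hn.csInf_eq
  exact ⟨this ▸ hn, n, this⟩

theorem card_mul_prod_normMin_le {A : GL (Fin d) (Kinf F)} {L : AddSubgroup (Fin d → Kinf F)}
    (hL : latticeSubgroup A ≤ L) {T : Finset (Fin d → Kinf F)} (hT : ∀ t ∈ T, t ∈ L)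
    (hinj : ∀ t ∈ T, ∀ t' ∈ T, t - t' ∈ lattice A → t = t')
    (hcover : ∀ y ∈ L, ∃ t ∈ T, y - t ∈ lattice A) :
    (T.card : ℝ) * ∏ i : Fin d, normMin (L : Set (Fin d → Kinf F)) (i + 1) ≤ absv A.1.det := by
  have hleast := fun i : Fin d => isLeast_normRadii (i := i + 1) hL hcover (by omega) i.2
  choose l hl using fun i => (hleast i).2
  obtain ⟨w, hw, hwS⟩ := exists_linearIndependent_of_normRadii (normMin (L : Set (Fin d → Kinf F))) d
    fun i h1 h2 => (isLeast_normRadii hL hcover h1 h2).1.1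
  have hmono : Monotone l := by
    intro i j hij
    rw [← zpow_le_zpow_iff_right₀ (one_lt_card_real F), ← hl, ← hl]
    exact (hleast i).1.2 (normRadii_anti _ (by simpa using hij) (hleast j).1.1)
  simp only [hl]
  refine card_mul_prod_zpow_le hL hT hinj hw hmono fun i y hy hlt => ?_
  rw [← hl] at hlt
  exact mem_span_of_supNorm_lt_normMin (bddBelow_normRadii _) hw hwS i hy hlt

end Minima

/-! ### Vectors of successive minima form an orthogonal lattice basis. -/

section Reduced

variable {F : Type*} [Field F] {d : ℕ}

theorem exists_det_eq_of_mem_lattice {A : GL (Fin d) (Kinf F)} {v : Fin d → Fin d → Kinf F}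
    (hv : ∀ i, v i ∈ lattice A) : ∃ D, (Matrix.of v).det = A.1.det * polyEmb F D := by
  choose P hP using hv
  refine ⟨(Matrix.of P).det, ?_⟩
  have h : Matrix.of v = (Matrix.of P).map (polyEmb F) * A.1.transpose := by
    ext1 i j
    rw [Matrix.of_apply, ← hP i]
    simp [Matrix.mul_apply, Matrix.mulVec, dotProduct, mul_comm]
  rw [h, Matrix.det_mul, Matrix.det_transpose, mul_comm, AlgHom.map_det]
  rfl

variable [Fintype F]

theorem exists_inv_polyEmb {D : F[X]} (hD : absv (polyEmb F D) = 1) :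
    ∃ E, polyEmb F D * polyEmb F E = 1 := by
  have h1 := (absv_le_zpow_iff (f := polyEmb F D) (n := 0)).mp (by simp [hD])
  have h2 : D = Polynomial.C (D.coeff 0) := by
    ext n
    rcases Nat.eq_zero_or_pos n with rfl | hn
    · simp
    · have := h1 (-(n : ℤ)) (by omega)
      rw [coeff_polyEmb, if_pos (by omega), neg_neg, Int.toNat_natCast] at this
      rw [this, Polynomial.coeff_C, if_neg hn.ne']
  have h3 : D.coeff 0 ≠ 0 := fun h => by
    rw [h2, h, map_zero, map_zero, absv_zero] at hD
    exact zero_ne_one hD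
  refine ⟨Polynomial.C (D.coeff 0)⁻¹, ?_⟩
  rw [← map_mul]
  conv_lhs => rw [h2]
  rw [← Polynomial.C_mul, Polynomial.coeff_C_zero, mul_inv_cancel₀ h3, map_one, map_one]

/-- Vectors realizing the successive minima of a lattice have the determinant of the lattice, and
equality holds for them in Hadamard's inequality. -/
theorem absv_det_of_normMin {A : GL (Fin d) (Kinf F)} {v : Fin d → Fin d → Kinf F}
    (hv : ∀ i, v i ∈ lattice A) (hli : LinearIndependent (Kinf F) v)
    (hmin : ∀ i : Fin d, supNorm (v i) = normMin (lattice A) (i + 1)) :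
    (Matrix.of v).det ≠ 0 ∧ absv (Matrix.of v).det = absv A.1.det ∧
      absv (Matrix.of v).det = ∏ i, supNorm (v i) := by
  have hdet : (Matrix.of v).det ≠ 0 :=
    (((Matrix.of v).isUnit_iff_isUnit_det).mp
      (Matrix.linearIndependent_rows_iff_isUnit.mp hli)).ne_zero
  -- Minkowski's theorem with L = Λ and a single coset. Together with Hadamard's inequality and the
  -- fact that det v is a nonzero polynomial times det A, all the inequalities become equalities.
  have h1 := card_mul_prod_normMin_le (A := A) (L := latticeSubgroup A) le_rfl (T := {0})
    (fun t ht => by rw [Finset.mem_singleton.mp ht]; exact zero_mem _)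
    (fun t ht t' ht' _ => by rw [Finset.mem_singleton.mp ht, Finset.mem_singleton.mp ht'])
    (fun y hy => ⟨0, by simp, by rwa [sub_zero]⟩)
  rw [Finset.card_singleton, Nat.cast_one, one_mul] at h1
  have h2 : ∏ i, supNorm (v i) ≤ absv A.1.det := by
    rw [Finset.prod_congr rfl fun i _ => hmin i]
    exact h1
  have h3 : absv (Matrix.of v).det ≤ ∏ i, supNorm (v i) := absv_det_le _
  obtain ⟨D, hD⟩ := exists_det_eq_of_mem_lattice hv
  have hD0 : D ≠ 0 := fun h => hdet (by rw [hD, h, map_zero, mul_zero])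
  have h4 : absv A.1.det ≤ absv (Matrix.of v).det := by
    rw [hD, absv_mul]
    exact le_mul_of_one_le_right (absv_nonneg _) (one_le_absv_polyEmb hD0)
  exact ⟨hdet, le_antisymm (h3.trans h2) h4, le_antisymm h3 (h2.trans h4)⟩

/-- Cramer's rule: c_j is a quotient of two determinants of lattice vectors, both polynomial
multiples of det A, and the multiplier in the denominator is a nonzero constant. -/
theorem coords_mem_of_mem_lattice {A : GL (Fin d) (Kinf F)} {v : Fin d → Fin d → Kinf F}
    (hv : ∀ i, v i ∈ lattice A)
    (hA : absv (Matrix.of v).det = absv A.1.det) {c : Fin d → Kinf F}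
    (hc : ∑ i, c i • v i ∈ lattice A) (j : Fin d) : c j ∈ Set.range (polyEmb F) := by
  obtain ⟨D, hD⟩ := exists_det_eq_of_mem_lattice hv
  have hA0 : A.1.det ≠ 0 := Matrix.GeneralLinearGroup.det_ne_zero A
  have hD1 : absv (polyEmb F D) = 1 := by
    rw [hD, absv_mul] at hA
    exact (mul_eq_left₀ (absv_pos hA0).ne').mp hA
  obtain ⟨E, hE⟩ := exists_inv_polyEmb hD1
  have hrow : ∀ i, (Matrix.of v).updateRow j (∑ i, c i • v i) i ∈ lattice A := by
    intro i
    rcases eq_or_ne i j with rfl | h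
    · rwa [Matrix.updateRow_self]
    · rw [Matrix.updateRow_ne h]; exact hv i
  obtain ⟨D', hD'⟩ := exists_det_eq_of_mem_lattice hrow
  have h1 := Matrix.det_updateRow_sum (Matrix.of v) j c
  have h2 : A.1.det * polyEmb F D' = c j * (A.1.det * polyEmb F D) := by
    rw [← hD', ← hD]; exact h1
  refine ⟨D' * E, mul_left_cancel₀ hA0 ?_⟩
  rw [map_mul, ← mul_assoc, h2]
  calc c j * (A.1.det * polyEmb F D) * polyEmb F E
      = A.1.det * c j * (polyEmb F D * polyEmb F E) := by ring
    _ = A.1.det * c j := by rw [hE, mul_one]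

end Reduced

/-! ### Polynomials of degree at most N. -/

section LowDegree

variable (F : Type*) [Field F] (N : ℕ)

theorem setOf_degree_le_eq :
    {Q : F[X] | Q.degree ≤ N} = (Polynomial.degreeLT F (N + 1) : Set F[X]) := by
  ext Q
  rw [SetLike.mem_coe, Polynomial.mem_degreeLT, Set.mem_ofPred_eq,
    Polynomial.degree_le_iff_coeff_zero, Polynomial.degree_lt_iff_coeff_zero]
  refine forall_congr' fun m => ?_
  rw [Nat.cast_lt, Nat.lt_iff_add_one_le]

theorem ncard_degree_le [Fintype F] : {Q : F[X] | Q.degree ≤ N}.ncard = Fintype.card F ^ (N + 1) := by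
  rw [setOf_degree_le_eq, ← Nat.card_coe_set_eq]
  refine (Nat.card_congr (Polynomial.degreeLTEquiv F (N + 1)).toEquiv).trans ?_
  simp

theorem finite_degree_le [Fintype F] : {Q : F[X] | Q.degree ≤ N}.Finite :=
  Set.finite_of_ncard_ne_zero (by rw [ncard_degree_le]; positivity)

theorem frac_add_polyEmb {F : Type*} [Field F] (f : Kinf F) (P : F[X]) :
    frac (f + polyEmb F P) = frac f := by
  have h : frac (f + polyEmb F P) = frac f + frac (polyEmb F P) := by
    ext m
    simp only [HahnSeries.coeff_add, coeff_frac]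
    split_ifs <;> simp
  rw [h, frac_polyEmb, add_zero]

end LowDegree

/-! ### Minors of fractional parts. -/

section Minors

variable {F : Type*} [Field F] [Fintype F]

theorem finite_fracMinors {d : ℕ} (a : Fin d → Kinf F) (N : ℕ) : (fracMinors a N).Finite := by
  have hfin : (⋃ k ∈ Set.Iic d, ⋃ j : Fin k ↪o Fin d,
      (fun Q => absv (fracMatrix a j Q).det) ''
        (Set.univ.pi fun _ : Fin k => {Q : F[X] | Q.degree ≤ N})).Finite :=
    (Set.finite_Iic d).biUnion fun k _ => Set.finite_iUnion fun j =>
      (Set.Finite.pi' fun _ => finite_degree_le F N).subset (by simp [Set.pi]) |>.image _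
  refine hfin.subset ?_
  rintro t ⟨k, _, hk, j, Q, hQ, rfl, _⟩
  exact Set.mem_biUnion (Set.mem_Iic.mpr hk)
    (Set.mem_iUnion.mpr ⟨j, Q, fun i _ => hQ i, rfl⟩)

/-- The 1 × 1 minor with Q = 1. It shows that the minors have a minimum, and that this is at most 1,
the value of the empty minor. -/
theorem exists_mem_fracMinors_lt_one {d : ℕ} {a : Fin d → Kinf F} {N : ℕ} {i : Fin d}
    (hi : a i ∉ Set.range (polyEmb F)) : ∃ t ∈ fracMinors a N, t < 1 := by
  have h0 : frac (a i) ≠ 0 := fun h => hi (frac_eq_zero_iff.mp h)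
  refine ⟨absv (frac (a i)), ⟨1, le_rfl, Fin.pos i,
    OrderEmbedding.ofStrictMono (fun _ => i) (Subsingleton.strictMono _), fun _ => 1, fun _ => ?_,
    ?_, absv_pos h0⟩, absv_frac_lt_one _⟩
  · rw [Polynomial.degree_one]
    exact_mod_cast Nat.zero_le N
  · rw [Matrix.det_fin_one]
    simp [fracMatrix]

omit [Fintype F] in
theorem det_eq_mul_det_submatrix_of_row {m : ℕ} (C : Matrix (Fin (m + 1)) (Fin (m + 1)) (Kinf F))
    {i j : Fin (m + 1)} (h : C i = Pi.single j 1) :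
    C.det = (-1) ^ ((i : ℕ) + j) * (C.submatrix i.succAbove j.succAbove).det := by
  rw [Matrix.det_succ_row C i, Finset.sum_eq_single j]
  · simp [h]
  · intro k _ hk
    simp [h, hk]
  · simp

/-- The determinant of an invertible matrix whose rows are vectors of fractional parts or
standard basis vectors is, up to sign, a minor of the matrix of fractional parts. -/
theorem exists_absv_det_eq_fracMatrix {n : ℕ} (a : Fin n → Kinf F) (N : ℕ)
    (C : Matrix (Fin n) (Fin n) (Kinf F)) (hC : C.det ≠ 0)
    (hrow : ∀ i, (∃ Q : F[X], Q.degree ≤ N ∧ ∀ l, C i l = frac (polyEmb F Q * a l)) ∨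
      ∃ j, C i = Pi.single j 1) :
    ∃ k ≤ n, ∃ (j : Fin k ↪o Fin n) (Q : Fin k → F[X]), (∀ i, (Q i).degree ≤ N) ∧
      absv C.det = absv (fracMatrix a j Q).det := by
  induction n with
  | zero =>
    -- The empty minor, with determinant 1, is what remains when every row is a unit vector.
    exact ⟨0, le_rfl, RelEmbedding.refl _, Fin.elim0, fun i => i.elim0, by simp⟩
  | succ m ih =>
    by_cases hall : ∀ i, ∃ Q : F[X], Q.degree ≤ N ∧ ∀ l, C i l = frac (polyEmb F Q * a l)
    · choose Q hQ hCQ using hall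
      refine ⟨m + 1, le_rfl, RelEmbedding.refl _, Q, hQ, ?_⟩
      congr 2
      ext1 i l
      exact hCQ i l
    · push Not at hall
      obtain ⟨i, hi⟩ := hall
      obtain ⟨j, hj⟩ := (hrow i).resolve_left fun ⟨Q, hQ, h⟩ => by
        obtain ⟨l, hl⟩ := hi Q hQ
        exact hl (h l)
      have hdet := det_eq_mul_det_submatrix_of_row C hj
      have hsub : (C.submatrix i.succAbove j.succAbove).det ≠ 0 := fun h =>
        hC (by rw [hdet, h, mul_zero])
      obtain ⟨k, hk, j', Q, hQ, heq⟩ := ih (a ∘ j.succAbove)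
        (C.submatrix i.succAbove j.succAbove) hsub (fun i' => by
          rcases hrow (i.succAbove i') with ⟨Q, hQ, h⟩ | ⟨l, hl⟩
          · exact Or.inl ⟨Q, hQ, fun l => h _⟩
          · refine Or.inr ?_
            rcases eq_or_ne l j with rfl | hlj
            -- A second row equal to the same unit vector would become zero after column j is
            -- deleted.
            · refine absurd (Matrix.det_eq_zero_of_row_eq_zero i' fun k => ?_) hsub
              rw [Matrix.submatrix_apply, hl, Pi.single_eq_of_ne (Fin.succAbove_ne l k)]
            · obtain ⟨l', rfl⟩ := Fin.exists_succAbove_eq hlj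
              refine ⟨l', funext fun k => ?_⟩
              rw [Matrix.submatrix_apply, hl]
              simp only [Pi.single_apply, Fin.succAbove_right_inj])
      refine ⟨k, by omega, j'.trans j.succAboveOrderEmb, Q, hQ, ?_⟩
      have hone : absv ((-1 : Kinf F) ^ ((i : ℕ) + j)) = 1 := by
        rw [← absvHom_apply, map_pow, absvHom_apply, absv_neg, absv_one, one_pow]
      rw [hdet, absv_mul, hone, one_mul, heq]
      rfl

end Minors

/-! ### The periodic set as a group. -/

section Periodic

variable {F : Type*} [Field F] {d : ℕ}

theorem mem_periodic_iff {Λ : Set (Fin d → Kinf F)} {α : Fin d → Kinf F} {N : ℕ}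
    {y : Fin d → Kinf F} :
    y ∈ periodic Λ α N ↔ ∃ Q : F[X], Q.degree ≤ N ∧ y - polyEmb F Q • α ∈ Λ := by
  simp only [periodic, Set.mem_iUnion, Set.mem_image, Set.mem_ofPred_eq]
  constructor
  · rintro ⟨Q, hQ, w, hw, rfl⟩
    exact ⟨Q, hQ, by simpa using hw⟩
  · rintro ⟨Q, hQ, hw⟩
    exact ⟨Q, hQ, _, hw, by simp⟩

/-- The periodic set `Λ(α, q^N)` as an additive subgroup, for the lattice `Λ = A R^d`. -/
def periodicSubgroup (A : GL (Fin d) (Kinf F)) (α : Fin d → Kinf F) (N : ℕ) :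
    AddSubgroup (Fin d → Kinf F) where
  carrier := periodic (lattice A) α N
  zero_mem' := mem_periodic_iff.mpr ⟨0, by simp,
    by rw [map_zero, zero_smul, sub_zero]; exact (latticeSubgroup A).zero_mem⟩
  add_mem' := by
    intro y y' hy hy'
    obtain ⟨Q, hQ, h⟩ := mem_periodic_iff.mp hy
    obtain ⟨Q', hQ', h'⟩ := mem_periodic_iff.mp hy'
    refine mem_periodic_iff.mpr ⟨Q + Q', Polynomial.degree_add_le_of_degree_le hQ hQ', ?_⟩
    rw [map_add, add_smul, add_sub_add_comm]
    exact (latticeSubgroup A).add_mem h h'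
  neg_mem' := by
    intro y hy
    obtain ⟨Q, hQ, h⟩ := mem_periodic_iff.mp hy
    refine mem_periodic_iff.mpr ⟨-Q, by rwa [Polynomial.degree_neg], ?_⟩
    rw [map_neg, neg_smul, ← neg_sub']
    exact (latticeSubgroup A).neg_mem h

theorem coe_periodicSubgroup (A : GL (Fin d) (Kinf F)) (α : Fin d → Kinf F) (N : ℕ) :
    (periodicSubgroup A α N : Set (Fin d → Kinf F)) = periodic (lattice A) α N := rfl

theorem mem_periodicSubgroup {A : GL (Fin d) (Kinf F)} {α : Fin d → Kinf F} {N : ℕ}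
    {y : Fin d → Kinf F} :
    y ∈ periodicSubgroup A α N ↔ ∃ Q : F[X], Q.degree ≤ N ∧ y - polyEmb F Q • α ∈ lattice A :=
  mem_periodic_iff

theorem latticeSubgroup_le_periodicSubgroup (A : GL (Fin d) (Kinf F)) (α : Fin d → Kinf F)
    (N : ℕ) : latticeSubgroup A ≤ periodicSubgroup A α N := fun y hy =>
  mem_periodicSubgroup.mpr ⟨0, by simp, by rwa [map_zero, zero_smul, sub_zero]⟩

theorem image_mulVec_lattice (B g : GL (Fin d) (Kinf F)) :
    B.1.mulVec '' lattice g = lattice (B * g) := by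
  rw [lattice, lattice, ← Set.range_comp]
  congr 1
  ext1 P
  simp [Matrix.mulVec_mulVec]

theorem image_mulVec_periodic (B : GL (Fin d) (Kinf F)) (Λ : Set (Fin d → Kinf F))
    (α : Fin d → Kinf F) (N : ℕ) :
    B.1.mulVec '' periodic Λ α N = periodic (B.1.mulVec '' Λ) (B.1.mulVec α) N := by
  simp only [periodic, Set.image_iUnion, Set.image_image, Matrix.mulVec_add, Matrix.mulVec_smul]

end Periodic

/-- A basis `v` of the lattice `A R^d` for which equality holds in Hadamard's inequality. -/
structure IsReduced {F : Type*} [Field F] [Fintype F] {d : ℕ} (A : GL (Fin d) (Kinf F))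
    (v : Fin d → Fin d → Kinf F) : Prop where
  mem : ∀ i, v i ∈ lattice A
  det_ne_zero : (Matrix.of v).det ≠ 0
  absv_det : absv (Matrix.of v).det = absv A.1.det
  prod_eq : absv (Matrix.of v).det = ∏ i, supNorm (v i)

/-! ### Cosets and short vectors of the periodic group in a reduced basis. -/

section Reduced

variable {F : Type*} [Field F] [Fintype F] {d : ℕ} {A : GL (Fin d) (Kinf F)}
  {v : Fin d → Fin d → Kinf F} {a α : Fin d → Kinf F} {N : ℕ}

theorem IsReduced.coords_mem (hv : IsReduced A v) {c : Fin d → Kinf F}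
    (hc : ∑ i, c i • v i ∈ lattice A) (j : Fin d) : c j ∈ Set.range (polyEmb F) :=
  coords_mem_of_mem_lattice hv.mem hv.absv_det hc j

theorem IsReduced.absv_mul_le (hv : IsReduced A v) (c : Fin d → Kinf F) (j : Fin d) :
    absv (c j) * supNorm (v j) ≤ supNorm (∑ i, c i • v i) :=
  absv_mul_supNorm_le_of_det_eq (Matrix.of v) hv.det_ne_zero hv.prod_eq c j

theorem IsReduced.exists_coords (hv : IsReduced A v) (y : Fin d → Kinf F) :
    ∃ c : Fin d → Kinf F, y = ∑ i, c i • v i := by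
  have hli : LinearIndependent (Kinf F) v :=
    Matrix.linearIndependent_rows_of_det_ne_zero hv.det_ne_zero
  have hspan := hli.span_eq_top_of_card_eq_finrank' (by simp)
  have hy : y ∈ Submodule.span (Kinf F) (Set.range v) := hspan ▸ Submodule.mem_top
  obtain ⟨c, hc⟩ := (Submodule.mem_span_range_iff_exists_fun (Kinf F)).mp hy
  exact ⟨c, hc.symm⟩

/-- The representatives are the vectors Qα. If Qα and Q'α agree modulo the lattice, (Q - Q')a_i is a
polynomial, hence 0, and Q = Q' at an index with a_i ≠ 0. -/
theorem IsReduced.exists_transversal (hv : IsReduced A v) (hα : α = ∑ i, a i • v i) (hα0 : α ≠ 0)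
    (hirr : ∀ i, ∀ Q : F[X], Q.degree ≤ N → polyEmb F Q * a i ∈ Set.range (polyEmb F) →
      polyEmb F Q * a i = 0) :
    ∃ T : Finset (Fin d → Kinf F), T.card = Fintype.card F ^ (N + 1) ∧
      (∀ t ∈ T, t ∈ periodicSubgroup A α N) ∧
      (∀ t ∈ T, ∀ t' ∈ T, t - t' ∈ lattice A → t = t') ∧
      ∀ y ∈ periodicSubgroup A α N, ∃ t ∈ T, y - t ∈ lattice A := by
  classical
  obtain ⟨i, hi⟩ : ∃ i, a i ≠ 0 := by
    by_contra! h
    exact hα0 (by simp [hα, h])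
  have hinj : ∀ Q Q' : F[X], Q.degree ≤ N → Q'.degree ≤ N →
      polyEmb F Q • α - polyEmb F Q' • α ∈ lattice A → Q = Q' := by
    intro Q Q' hQ hQ' h
    rw [← sub_smul, ← map_sub, hα, Finset.smul_sum] at h
    simp only [smul_smul] at h
    have h1 := hirr i (Q - Q') (Polynomial.degree_sub_le_of_le hQ hQ' |>.trans (by simp))
      (hv.coords_mem h i)
    have h2 := (mul_eq_zero.mp h1).resolve_right hi
    exact sub_eq_zero.mp (polyEmb_injective (h2.trans (map_zero _).symm))
  refine ⟨(finite_degree_le F N).toFinset.image fun Q => polyEmb F Q • α, ?_, ?_, ?_, ?_⟩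
  · rw [Finset.card_image_of_injOn, ← Set.ncard_eq_toFinset_card _ (finite_degree_le F N), ncard_degree_le]
    intro Q hQ Q' hQ' h
    refine hinj Q Q' (by simpa using hQ) (by simpa using hQ') ?_
    rw [sub_eq_zero.mpr h]
    exact (latticeSubgroup A).zero_mem
  · intro t ht
    obtain ⟨Q, hQ, rfl⟩ := Finset.mem_image.mp ht
    exact mem_periodicSubgroup.mpr ⟨Q, by simpa using hQ,
      by rw [sub_self]; exact (latticeSubgroup A).zero_mem⟩
  · intro t ht t' ht' h
    obtain ⟨Q, hQ, rfl⟩ := Finset.mem_image.mp ht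
    obtain ⟨Q', hQ', rfl⟩ := Finset.mem_image.mp ht'
    rw [hinj Q Q' (by simpa using hQ) (by simpa using hQ') h]
  · intro y hy
    obtain ⟨Q, hQ, h⟩ := mem_periodicSubgroup.mp hy
    exact ⟨_, Finset.mem_image_of_mem _ (by simpa using hQ), h⟩

/-- The vectors `∑ ⟨Q a_j⟩ v_j` of fractional parts, together with the basis vectors `v_j`. -/
def reducedVectors (v : Fin d → Fin d → Kinf F) (a : Fin d → Kinf F) (N : ℕ) :
    Set (Fin d → Kinf F) :=
  {y | ∃ Q : F[X], Q.degree ≤ N ∧ y = ∑ j, frac (polyEmb F Q * a j) • v j} ∪ Set.range v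

/-- Orthogonality of `v` bounds each |b_j| ‖v_j‖ by the norm of y = ∑ b_j v_j. Passing to fractional
parts of the b_j keeps these bounds, and the difference involves only those v_j that are themselves
short enough. -/
theorem IsReduced.mem_span_reducedVectors (hv : IsReduced A v) (hα : α = ∑ i, a i • v i)
    {y : Fin d → Kinf F} (hy : y ∈ periodicSubgroup A α N) {r : ℝ} (hr : supNorm y ≤ r) :
    y ∈ Submodule.span (Kinf F) (reducedVectors v a N ∩ normBall F d r) := by
  obtain ⟨Q, hQ, hlat⟩ := mem_periodicSubgroup.mp hy
  obtain ⟨b, hb⟩ := hv.exists_coords y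
  have hbr : ∀ j, absv (b j) * supNorm (v j) ≤ r := fun j =>
    (hv.absv_mul_le b j).trans (hb ▸ hr)
  have hr0 : 0 ≤ r := (supNorm_nonneg y).trans hr
  have hfrac : ∀ j, frac (b j) = frac (polyEmb F Q * a j) := by
    rw [hb, hα, Finset.smul_sum, ← Finset.sum_sub_distrib] at hlat
    simp only [smul_smul, ← sub_smul] at hlat
    intro j
    obtain ⟨P, hP⟩ := hv.coords_mem hlat j
    rw [← frac_add_polyEmb (polyEmb F Q * a j) P, hP, add_sub_cancel]
  have hsplit : y = ∑ j, frac (b j) • v j + ∑ j, (b j - frac (b j)) • v j := by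
    rw [← Finset.sum_add_distrib, hb]
    simp only [← add_smul, add_sub_cancel]
  rw [hsplit]
  refine add_mem (Submodule.subset_span ⟨Or.inl ⟨Q, hQ, by simp only [hfrac]⟩, ?_⟩)
    (Submodule.sum_mem _ fun j _ => ?_)
  · refine supNorm_sum_le _ _ hr0 fun j _ => ?_
    rw [supNorm_smul]
    exact (mul_le_mul_of_nonneg_right (absv_frac_le _) (supNorm_nonneg _)).trans (hbr j)
  · obtain ⟨P, hP⟩ := exists_polyEmb_eq_sub_frac (b j)
    by_cases hP0 : P = 0
    · rw [← hP, hP0, map_zero, zero_smul]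
      exact zero_mem _
    · refine Submodule.smul_mem _ _ (Submodule.subset_span ⟨Or.inr ⟨j, rfl⟩, ?_⟩)
      -- A nonzero polynomial part forces |b_j| ≥ 1, so ‖v_j‖ ≤ |b_j| ‖v_j‖ ≤ r.
      have h1 : 1 ≤ absv (b j) :=
        (one_le_absv_polyEmb hP0).trans (hP ▸ absv_sub_frac_le (b j))
      exact (le_mul_of_one_le_left (supNorm_nonneg _) h1).trans (hbr j)

theorem IsReduced.normRadii_subset (hv : IsReduced A v) (hα : α = ∑ i, a i • v i) (i : ℕ) :
    normRadii (periodicSubgroup A α N : Set (Fin d → Kinf F)) i ⊆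
      normRadii (reducedVectors v a N) i := fun _ hr =>
  ⟨hr.1, hr.2.trans (Submodule.finrank_mono (Submodule.span_le.mpr fun _ hy =>
    hv.mem_span_reducedVectors hα hy.1 hy.2))⟩

/-- Hadamard's inequality applies to d independent reduced vectors within the minima. Their
determinant is that of the basis times that of a coordinate matrix, which reduces to a minor; `hone`
covers the empty minor. -/
theorem IsReduced.minFracMinor_mul_le (hv : IsReduced A v) (hα : α = ∑ i, a i • v i)
    (hone : minFracMinor a N ≤ 1)
    (hmin : ∀ i, 1 ≤ i → i ≤ d →
      normMin (periodicSubgroup A α N : Set (Fin d → Kinf F)) i ∈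
        normRadii (periodicSubgroup A α N : Set (Fin d → Kinf F)) i) :
    minFracMinor a N * absv A.1.det ≤
      ∏ i : Fin d, normMin (periodicSubgroup A α N : Set (Fin d → Kinf F)) (i + 1) := by
  obtain ⟨w, hw, hwS⟩ := exists_linearIndependent_of_normRadii (S := reducedVectors v a N)
    (normMin (periodicSubgroup A α N : Set (Fin d → Kinf F))) d
    fun i h1 h2 => hv.normRadii_subset hα i (hmin i h1 h2)
  have hdet : (Matrix.of w).det ≠ 0 :=
    (((Matrix.of w).isUnit_iff_isUnit_det).mp
      (Matrix.linearIndependent_rows_iff_isUnit.mp hw)).ne_zero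
  have hle : absv (Matrix.of w).det ≤
      ∏ i : Fin d, normMin (periodicSubgroup A α N : Set (Fin d → Kinf F)) (i + 1) :=
    (absv_det_le _).trans (Finset.prod_le_prod (fun _ _ => supNorm_nonneg _) fun i _ => (hwS i).2)
  have hrows : ∀ i, ∃ c : Fin d → Kinf F, w i = ∑ j, c j • v j ∧
      ((∃ Q : F[X], Q.degree ≤ N ∧ ∀ l, c l = frac (polyEmb F Q * a l)) ∨
        ∃ j, c = Pi.single j 1) := by
    intro i
    rcases (hwS i).1 with ⟨Q, hQ, h⟩ | ⟨j, hj⟩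
    · exact ⟨_, h, Or.inl ⟨Q, hQ, fun _ => rfl⟩⟩
    · refine ⟨Pi.single j 1, ?_, Or.inr ⟨j, rfl⟩⟩
      simp [Pi.single_apply, hj]
  choose C hC hCrow using hrows
  have hmul : Matrix.of w = Matrix.of C * Matrix.of v := by
    ext1 i l
    simp [hC i, Matrix.mul_apply]
  rw [hmul, Matrix.det_mul] at hdet hle
  rw [absv_mul, hv.absv_det] at hle
  refine le_trans (mul_le_mul_of_nonneg_right ?_ (absv_nonneg _)) hle
  have hC0 := left_ne_zero_of_mul hdet
  obtain ⟨k, hk, j, Q, hQ, heq⟩ := exists_absv_det_eq_fracMatrix a N (Matrix.of C) hC0 hCrow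
  rcases Nat.eq_zero_or_pos k with rfl | hk0
  · rw [heq, Matrix.det_isEmpty, absv_one]
    exact hone
  · exact csInf_le ⟨0, fun t ht => by obtain ⟨_, _, _, _, _, _, _, h⟩ := ht; exact h.le⟩
      ⟨k, hk0, hk, j, Q, hQ, heq, absv_pos hC0⟩

end Reduced

theorem prod_Icc_one_eq_prod_fin (f : ℕ → ℝ) (d : ℕ) :
    ∏ i ∈ Finset.Icc 1 d, f i = ∏ i : Fin d, f (i + 1) := by
  rw [Fin.prod_univ_eq_prod_range (fun i => f (i + 1)) d,
    ← Finset.Ico_add_one_right_eq_Icc, Finset.prod_Ico_eq_prod_range]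
  simp only [add_tsub_cancel_right, add_comm]

/-! ### Passage from a convex body to the unit cube. -/

section Transfer

variable {F : Type*} [Field F] [Fintype F] {d : ℕ}

theorem isReduced_of_isSuccMinFamily {g h : GL (Fin d) (Kinf F)} {v : Fin d → Fin d → Kinf F}
    (hv : IsSuccMinFamily (convexBody h) (lattice g) v) :
    IsReduced (h⁻¹ * g) fun i => (h⁻¹ : GL _ _).1.mulVec (v i) := by
  obtain ⟨hmem, hli, hnorm⟩ := hv
  have hmem' : ∀ i, (h⁻¹ : GL _ _).1.mulVec (v i) ∈ lattice (h⁻¹ * g) := fun i =>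
    image_mulVec_lattice h⁻¹ g ▸ Set.mem_image_of_mem _ (hmem i)
  have hli' : LinearIndependent (Kinf F) fun i => (h⁻¹ : GL _ _).1.mulVec (v i) :=
    hli.map' (h⁻¹ : GL _ _).1.mulVecLin
      (LinearMap.ker_eq_bot.mpr (mulVecEquiv h⁻¹).injective)
  obtain ⟨h1, h2, h3⟩ := absv_det_of_normMin hmem' hli' fun i => by
    rw [← bodyNorm_convexBody, hnorm, succMin_convexBody, image_mulVec_lattice]
  exact ⟨hmem', h1, h2, h3⟩

end Transfer

end PeriodicLattice

end

/-! ### The main theorem. -/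

open PeriodicLattice in
theorem mainTheorem1 {F : Type*} [Field F] [Fintype F] (d : ℕ) (hd : 2 ≤ d) (N : ℕ)
    (g h : GL (Fin d) (PeriodicLattice.Kinf F))
    (v : Fin d → Fin d → PeriodicLattice.Kinf F)
    (hv : PeriodicLattice.IsSuccMinFamily
      (PeriodicLattice.convexBody h) (PeriodicLattice.lattice g) v)
    (a : Fin d → PeriodicLattice.Kinf F) (α : Fin d → PeriodicLattice.Kinf F)
    (hα : α = ∑ i, a i • v i) (hα0 : α ≠ 0)
    (hirr : ∀ i, {y | ∃ Q : Polynomial F, Q.degree ≤ N ∧ y = PeriodicLattice.polyEmb F Q * a i} ∩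
      Set.range (PeriodicLattice.polyEmb F) = {0}) :
    (∀ i ∈ Finset.Icc 1 d, IsLeast
      (PeriodicLattice.minimaRadii (PeriodicLattice.convexBody h)
        (PeriodicLattice.periodic (PeriodicLattice.lattice g) α N) i)
      (PeriodicLattice.succMin (PeriodicLattice.convexBody h)
        (PeriodicLattice.periodic (PeriodicLattice.lattice g) α N) i)) ∧
    IsLeast (PeriodicLattice.fracMinors a N) (PeriodicLattice.minFracMinor a N) ∧
    PeriodicLattice.minFracMinor a N *
        (PeriodicLattice.latticeDet g / PeriodicLattice.vol (PeriodicLattice.convexBody h)) ≤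
      ∏ i ∈ Finset.Icc 1 d, PeriodicLattice.succMin (PeriodicLattice.convexBody h)
        (PeriodicLattice.periodic (PeriodicLattice.lattice g) α N) i ∧
    ∏ i ∈ Finset.Icc 1 d, PeriodicLattice.succMin (PeriodicLattice.convexBody h)
        (PeriodicLattice.periodic (PeriodicLattice.lattice g) α N) i ≤
      PeriodicLattice.latticeDet g /
        ((Fintype.card F : ℝ) ^ (N + 1) *
          PeriodicLattice.vol (PeriodicLattice.convexBody h)) ∧
    ∃ k : ℕ, 1 ≤ k ∧ k ≤ d ∧ ∃ (l : Fin k ↪o Fin d) (Q : Fin k → Polynomial F),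
      (∀ i, (Q i).degree ≤ N) ∧
      PeriodicLattice.absv (PeriodicLattice.fracMatrix a l Q).det ≠ 0 ∧
      PeriodicLattice.absv (PeriodicLattice.fracMatrix a l Q).det ≤
        1 / (Fintype.card F : ℝ) ^ (N + 1) := by
  set A : GL (Fin d) (Kinf F) := h⁻¹ * g with hA
  set v' : Fin d → Fin d → Kinf F := fun i => (h⁻¹ : GL _ _).1.mulVec (v i) with hv'
  set α' : Fin d → Kinf F := (h⁻¹ : GL _ _).1.mulVec α with hα'
  have hred : IsReduced A v' := isReduced_of_isSuccMinFamily hv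
  have hα1 : α' = ∑ i, a i • v' i := by
    rw [hα', hα, Matrix.mulVec_sum]
    simp only [Matrix.mulVec_smul, hv']
  have hα2 : α' ≠ 0 := fun h0 => hα0 (by
    have := congrArg h.1.mulVec h0
    simpa [hα', Matrix.mulVec_mulVec] using this)
  have hirr' : ∀ i, ∀ Q : Polynomial F, Q.degree ≤ N →
      polyEmb F Q * a i ∈ Set.range (polyEmb F) → polyEmb F Q * a i = 0 := fun i Q hQ hr =>
    (hirr i).subset ⟨⟨Q, hQ, rfl⟩, hr⟩
  obtain ⟨T, hcard, hT, hinj, hcover⟩ := hred.exists_transversal hα1 hα2 hirr'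
  have hL := latticeSubgroup_le_periodicSubgroup A α' N
  have hset : (h⁻¹ : GL _ _).1.mulVec '' periodic (lattice g) α N = periodicSubgroup A α' N := by
    rw [image_mulVec_periodic, image_mulVec_lattice, coe_periodicSubgroup]
  have hleast := fun i (h1 : 1 ≤ i) (h2 : i ≤ d) => (isLeast_normRadii hL hcover h1 h2).1
  obtain ⟨i, hi⟩ : ∃ i, a i ≠ 0 := by
    by_contra! h0
    exact hα0 (by simp [hα, h0])
  -- The case Q = 1 of the hypothesis: a nonzero coordinate of α is not a polynomial.
  have hai : a i ∉ Set.range (polyEmb F) := fun hr => hi (by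
    have := hirr' i 1 (by rw [Polynomial.degree_one]; exact_mod_cast Nat.zero_le N)
    rw [map_one, one_mul] at this
    exact this hr)
  obtain ⟨t, ht, ht1⟩ := exists_mem_fracMinors_lt_one (N := N) hai
  have hminor : IsLeast (fracMinors a N) (minFracMinor a N) :=
    ⟨Set.Nonempty.csInf_mem ⟨t, ht⟩ (finite_fracMinors a N),
      fun _ hs => csInf_le (finite_fracMinors a N).bddBelow hs⟩
  have hlow := hred.minFracMinor_mul_le hα1 ((hminor.2 ht).trans ht1.le)
    fun i h1 h2 => (hleast i h1 h2).1
  have hup := card_mul_prod_normMin_le hL hT hinj hcover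
  rw [hcard, Nat.cast_pow] at hup
  have hh : 0 < absv h.1.det := absv_pos (Matrix.GeneralLinearGroup.det_ne_zero h)
  have hg : 0 < absv g.1.det := absv_pos (Matrix.GeneralLinearGroup.det_ne_zero g)
  have hdetA : absv A.1.det = absv g.1.det / absv h.1.det := by
    rw [eq_div_iff hh.ne', ← absv_mul, mul_comm, ← Matrix.det_mul, ← Units.val_mul, hA,
      mul_inv_cancel_left]
  have hq : (0 : ℝ) < (Fintype.card F : ℝ) ^ (N + 1) :=
    pow_pos (zero_lt_one.trans (one_lt_card_real F)) _
  have hprod : ∏ i ∈ Finset.Icc 1 d, succMin (convexBody h) (periodic (lattice g) α N) i =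
      ∏ i : Fin d, normMin (periodicSubgroup A α' N : Set (Fin d → Kinf F)) (i + 1) := by
    rw [prod_Icc_one_eq_prod_fin]
    simp only [succMin_convexBody, hset]
  have hlow' : minFracMinor a N * (latticeDet g / vol (convexBody h)) ≤
      ∏ i ∈ Finset.Icc 1 d, succMin (convexBody h) (periodic (lattice g) α N) i := by
    rw [hprod, vol_convexBody, latticeDet, ← hdetA]
    exact hlow
  have hup' : ∏ i ∈ Finset.Icc 1 d, succMin (convexBody h) (periodic (lattice g) α N) i ≤
      latticeDet g / ((Fintype.card F : ℝ) ^ (N + 1) * vol (convexBody h)) := by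
    rw [hprod, vol_convexBody, latticeDet, mul_comm, ← div_div, ← hdetA, le_div_iff₀' hq]
    exact hup
  refine ⟨fun i hi => ?_, hminor, hlow', hup', ?_⟩
  · rw [succMin_convexBody, minimaRadii_convexBody, hset]
    exact hleast i (Finset.mem_Icc.mp hi).1 (Finset.mem_Icc.mp hi).2
  · obtain ⟨k, hk1, hkd, j, Q, hQ, heq, hpos⟩ := hminor.1
    refine ⟨k, hk1, hkd, j, Q, hQ, heq ▸ hpos.ne', heq ▸ ?_⟩
    -- The least minor is the one sought: the positive factor det Λ / m(C) cancels between the two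
    -- bounds.
    have h1 := hlow'.trans hup'
    rw [vol_convexBody, latticeDet, mul_comm ((Fintype.card F : ℝ) ^ (N + 1)), ← div_div,
      div_eq_mul_one_div (absv g.1.det / absv h.1.det), mul_comm] at h1
    exact le_of_mul_le_mul_left h1 (div_pos hg hh)
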